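/- Let $\alpha\in(0,\infty)$ and $r\in\mathbb{N}$, and let $n,p\to\infty$ along a sequence with $p/n\to\alpha$. Let $\mathbf Z\in\mathbb{R}^{n\times p}$ have i.i.d. $\mathsf N(0,1)$ entries. For orthonormal vectors $\mathbf v_1,\dots,\mathbf v_r\in\mathbb{R}^p$ let $\mathsf Q=\bigcup_{q\le r}\operatorname{supp}(\mathbf v_q)\subseteq[p]$ and $\mathsf F=\{(i,j): i,j\in[p]\setminus\mathsf Q,\ i\ne j\}$. With the soft thresholding function $\eta(z;t)=\operatorname{sgn}(z)(|z|-t)_+$, let $\mathbf N\in\mathbb{R}^{p\times p}$ be the matrix with entries $$\mathbf N_{ij}=\eta\Big(\tfrac1n(\mathbf Z^{\sf T}\mathbf Z)_{ij};\,\tfrac{\tau}{\sqrt n}\Big)\ \text{ if } (i,j)\in\mathsf F,\qquad \mathbf N_{ij}=0\ \text{ otherwise.}$$ Set $\tau_1(\alpha)=100\max(1,\alpha^2\log\alpha)$ and $C_1(\alpha)=5000\max(1,\alpha^{3/2})$. Then for every $\tau\ge\tau_1(\alpha)$ there is a point of the sequence beyond which, for every choice of $\mathbf v_1,\dots,\mathbf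 v_r$ as above, $$\mathbb P\Big\{\|\mathbf N\|_2\le C_1(\alpha)\sqrt{\tfrac{\log\tau}{\tau}}\Big\}\ \ge\ 1-2\exp\Big(-\frac{p}{4\tau}\Big),$$ where $\|\cdot\|_2$ is the operator (spectral) norm. -/

import Mathlib

open MeasureTheory ProbabilityTheory Filter Topology

noncomputable section

/-- Soft thresholding `η(z; t) = sgn(z) (|z| - t)₊`. -/
def softThreshold (t z : ℝ) : ℝ := Real.sign z * max (|z| - t) 0

open Classical in
/-- The projection `P_E` keeping the entries of a matrix with index in `E` and setting the
others to zero. -/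
def entryProj {m n : ℕ} (E : Set (Fin m × Fin n)) (A : Matrix (Fin m) (Fin n) ℝ) :
    Matrix (Fin m) (Fin n) ℝ :=
  Matrix.of fun i j => if (i, j) ∈ E then A i j else 0

/-- The spectral norm: the operator norm with respect to the Euclidean norm. -/
def opNorm {p : ℕ} (A : Matrix (Fin p) (Fin p) ℝ) : ℝ :=
  ‖Matrix.toEuclideanCLM (n := Fin p) (𝕜 := ℝ) A‖

/-- `Z` is a random matrix whose entries are i.i.d. standard normal under `P`. -/
structure IsStdGaussianMatrix {Ω : Type*} [MeasurableSpace Ω] (P : Measure Ω) {n p : ℕ}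
    (Z : Ω → Matrix (Fin n) (Fin p) ℝ) : Prop where
  hasLaw : ∀ i j, HasLaw (fun ω => Z ω i j) (gaussianReal 0 1) P
  indep : iIndepFun (fun (ij : Fin n × Fin p) ω => Z ω ij.1 ij.2) P

/-- The union `Q` of the supports of the vectors `v 0, …, v (r - 1)`. -/
def supportUnion {r p : ℕ} (v : Fin r → EuclideanSpace ℝ (Fin p)) : Set (Fin p) :=
  ⋃ q, {i | v q i ≠ 0}

/-- The diagonal positions `D = {(i, i) : i ∉ Q}`. -/
def diagPositions {p : ℕ} (Q : Set (Fin p)) : Set (Fin p × Fin p) :=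
  {ij | ij.1 = ij.2 ∧ ij.1 ∉ Q}

/-- The noise positions `F = (Qᶜ × Qᶜ) \ D`. -/
def noisePositions {p : ℕ} (Q : Set (Fin p)) : Set (Fin p × Fin p) :=
  (Qᶜ ×ˢ Qᶜ) \ diagPositions Q

/-- The noise matrix `N = P_F {η(Zᵀ Z / n; τ / √n)}`, with `η` applied entrywise. -/
def noiseMatrix {n p : ℕ} (Q : Set (Fin p)) (τ : ℝ) (Z : Matrix (Fin n) (Fin p) ℝ) :
    Matrix (Fin p) (Fin p) ℝ :=
  entryProj (noisePositions Q)
    (((1 / (n : ℝ)) • (Z.transpose * Z)).map (softThreshold (τ / √(n : ℝ))))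

end

/-!
Since passing to the rows and columns outside `Q` does not increase the operator norm, it suffices
to treat the thresholded Gram matrix with zero diagonal for `Q = ∅`. Up to a small entrywise error
the soft threshold may be replaced by a continuously differentiable one, `smoothThreshold`, whose
derivative `ramp` vanishes below the threshold.

*Concentration.* For fixed vectors `a`, `b` the bilinear form of the matrix at `(a, b)` is a smooth
function `gramForm` of the Gaussian columns `z`, with mean zero because the threshold is odd and
the law of `z` is invariant under the negation of a column. Its gradient is bounded only where the
operator norm of `z` is, so a localised form of the Maurey–Pisier inequality is used
(`lintegral_exp_sub_le_of_gradient_le`): the quarter circle between two points of the set where the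
squared operator norm is at most `R` stays in the set where it is at most `2 * R`, so that the
gradient is needed on the latter set only. With `h'` the derivative of the threshold, the squared
gradient is at most `8 * R * ∑ (a i * b j * h' i j) ^ 2`. This is at most `8 * R` in general, and
much smaller if the squared entries of `b` are at most `τ / (16 * p)`: a row of the Gram matrix has
at most `4 * R ^ 2 / (τ ^ 2 * n)` entries above the threshold, and only these contribute.

*Union bound.* The vectors `a`, `b` range over the points of the lattice of mesh `1 / (4 * √p)` in
the unit ball, which suffices to bound the operator norm up to a factor `2`
(`opNorm_le_of_forall_inner_netPoint`). Each lattice vector is the sum of a vector with small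
entries (`spreadNet`) and a vector whose nonzero entries are large (`sparseNet`). There are
`exp (O (p))` pairs with a spread vector, which the small gradient compensates
(`spread_exponent_ge`), and only `exp (O (p * log τ / τ))` pairs of sparse vectors, for which the
general gradient bound is enough (`sparse_exponent_ge`). The operator norm of the columns
themselves is controlled by the same net and an exponential moment of the squared norm
(`stdGaussian_real_compl_boundedColumns_le`).
-/

/-! ### Localised Gaussian concentration -/

section GaussianConcentration

open scoped InnerProductSpace ENNReal

variable {E : Type*} [NormedAddCommGroup E] [InnerProductSpace ℝ E]

/-- A chain-rule form of the fundamental theorem of calculus along the quarter circle from `x`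
to `y`, followed by Jensen's inequality for the exponential. -/
lemma exp_sub_le_integral_rotation {f : E → ℝ} {g : E → E} (hg : Continuous g)
    (hf : ∀ x, HasFDerivAt f (innerSL ℝ (g x)) x) (x y : E) :
    Real.exp (f y - f x) ≤ 2 / Real.pi * ∫ θ in Set.Ioc 0 (Real.pi / 2),
      Real.exp (Real.pi / 2 * ⟪g (Real.cos θ • x + Real.sin θ • y),
        -Real.sin θ • x + Real.cos θ • y⟫_ℝ) := by
  set G : ℝ → ℝ := fun θ => ⟪g (Real.cos θ • x + Real.sin θ • y),
        -Real.sin θ • x + Real.cos θ • y⟫_ℝ with hG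
  have hpi := Real.pi_pos
  have hGc : Continuous G := by
    refine Continuous.inner (hg.comp ?_) ?_ <;> fun_prop
  have hder : ∀ θ, HasDerivAt (fun θ => f (Real.cos θ • x + Real.sin θ • y)) (G θ) θ := by
    intro θ
    have h1 : HasDerivAt (fun θ => Real.cos θ • x + Real.sin θ • y)
        (-Real.sin θ • x + Real.cos θ • y) θ :=
      ((Real.hasDerivAt_cos θ).smul_const x).add ((Real.hasDerivAt_sin θ).smul_const y)
    exact (hf _).comp_hasDerivAt θ h1
  have hFTC : ∫ θ in (0:ℝ)..(Real.pi / 2), G θ = f y - f x := by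
    rw [intervalIntegral.integral_eq_sub_of_hasDerivAt (fun θ _ => hder θ)
      (hGc.intervalIntegrable _ _)]
    simp
  rw [intervalIntegral.integral_of_le (by positivity)] at hFTC
  have hvol : (volume.restrict (Set.Ioc 0 (Real.pi / 2))).real Set.univ = Real.pi / 2 := by
    simp [Measure.real, hpi.le, div_nonneg]
  have : NeZero (volume.restrict (Set.Ioc 0 (Real.pi / 2))) := by
    refine ⟨fun h => ?_⟩
    rw [h] at hvol
    simp at hvol
    linarith
  have hJ := convexOn_exp.map_average_le (μ := volume.restrict (Set.Ioc 0 (Real.pi / 2)))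
    (f := fun θ => Real.pi / 2 * G θ) Real.continuous_exp.continuousOn isClosed_univ (by simp)
    ((hGc.const_mul _).integrableOn_Ioc)
    ((Real.continuous_exp.comp (hGc.const_mul _)).integrableOn_Ioc)
  rw [average_eq, average_eq, hvol, integral_const_mul, hFTC, smul_eq_mul, smul_eq_mul,
    ← mul_assoc, inv_mul_cancel₀ (by positivity), one_mul, inv_div] at hJ
  exact hJ

variable [FiniteDimensional ℝ E] [MeasurableSpace E] [BorelSpace E]

lemma lintegral_exp_inner_stdGaussian (v : E) :
    ∫⁻ x, ENNReal.ofReal (Real.exp ⟪v, x⟫_ℝ) ∂(stdGaussian E)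
      = ENNReal.ofReal (Real.exp (‖v‖ ^ 2 / 2)) := by
  have hmap : (stdGaussian E).map (innerSL ℝ v) = gaussianReal 0 (‖v‖ ^ 2).toNNReal := by
    rw [IsGaussian.map_eq_gaussianReal, variance_dual_stdGaussian,
      integral_strongDual_stdGaussian, innerSL_apply_norm]
  have hmgf := mgf_gaussianReal hmap 1
  have hint : Integrable (fun x => Real.exp ⟪v, x⟫_ℝ) (stdGaussian E) := by
    have h : Integrable (fun x => Real.exp (1 * (innerSL ℝ v) x)) (stdGaussian E) := by
      have h2 := integrable_exp_mul_gaussianReal (μ := 0) (v := (‖v‖ ^ 2).toNNReal) 1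
      rw [← hmap] at h2
      exact h2.comp_measurable (by fun_prop)
    simpa using h
  rw [← ofReal_integral_eq_lintegral_ofReal hint (ae_of_all _ fun _ => (Real.exp_pos _).le)]
  congr 1
  simpa [mgf] using hmgf

/-- **Localised Maurey–Pisier inequality.** The gradient of `f` only has to be bounded on a set
`S'` containing every quarter circle between two points of `S`. Along such a quarter circle the
position and the velocity of a pair of independent standard Gaussian vectors remain independent
standard Gaussian vectors. -/
theorem lintegral_exp_sub_le_of_gradient_le {f : E → ℝ} {g : E → E} (hg : Continuous g)
    (hf : ∀ x, HasFDerivAt f (innerSL ℝ (g x)) x) {S S' : Set E} (hS : MeasurableSet S)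
    (hS' : MeasurableSet S')
    (hSS' : ∀ x ∈ S, ∀ y ∈ S, ∀ θ : ℝ, Real.cos θ • x + Real.sin θ • y ∈ S')
    {B : ℝ} (hB : ∀ x ∈ S', ‖g x‖ ^ 2 ≤ B) :
    ∫⁻ z in S ×ˢ S, ENNReal.ofReal (Real.exp (f z.2 - f z.1))
        ∂((stdGaussian E).prod (stdGaussian E))
      ≤ ENNReal.ofReal (Real.exp (Real.pi ^ 2 / 8 * B)) := by
  have hpi := Real.pi_pos
  set γ := stdGaussian E
  set F : E × E → ℝ≥0∞ := fun w => S'.indicator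
    (fun u => ENNReal.ofReal (Real.exp (Real.pi / 2 * ⟪g u, w.2⟫_ℝ))) w.1 with hF
  set R : ℝ → E × E → E × E := fun θ z =>
    (Real.cos θ • z.1 + Real.sin θ • z.2, -Real.sin θ • z.1 + Real.cos θ • z.2) with hR
  have hFm : Measurable F := by
    have : F = (Prod.fst ⁻¹' S').indicator
        (fun w : E × E => ENNReal.ofReal (Real.exp (Real.pi / 2 * ⟪g w.1, w.2⟫_ℝ))) := by
      ext w; rfl
    rw [this]
    refine Measurable.indicator ?_ (measurable_fst hS')
    have : Continuous fun w : E × E => Real.exp (Real.pi / 2 * ⟪g w.1, w.2⟫_ℝ) := by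
      have := (hg.comp continuous_fst).inner (𝕜 := ℝ) (continuous_snd (X := E) (Y := E))
      exact Real.continuous_exp.comp (this.const_mul _)
    exact this.measurable.ennreal_ofReal
  have hRm : Measurable fun q : (E × E) × ℝ => R q.2 q.1 := by
    have : Continuous fun q : (E × E) × ℝ => R q.2 q.1 := by
      simp only [hR]; fun_prop
    exact this.measurable
  have hrot : ∀ θ, ∫⁻ z, F (R θ z) ∂(γ.prod γ) = ∫⁻ z, F z ∂(γ.prod γ) := by
    intro θ
    have h := IsGaussian.map_rotation_eq_self (μ := γ) (by simp [γ, integral_id_stdGaussian]) θ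
    conv_rhs => rw [← h, lintegral_map hFm (by fun_prop)]
    rfl
  have hFle : ∫⁻ z, F z ∂(γ.prod γ) ≤ ENNReal.ofReal (Real.exp (Real.pi ^ 2 / 8 * B)) := by
    rw [lintegral_prod _ hFm.aemeasurable]
    calc ∫⁻ u, ∫⁻ v, F (u, v) ∂γ ∂γ
        ≤ ∫⁻ u, ENNReal.ofReal (Real.exp (Real.pi ^ 2 / 8 * B)) ∂γ := by
          refine lintegral_mono fun u => ?_
          by_cases hu : u ∈ S'
          · have h1 : ∀ v, F (u, v)
                = ENNReal.ofReal (Real.exp ⟪(Real.pi / 2) • g u, v⟫_ℝ) := by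
              intro v; simp [hF, hu, real_inner_smul_left]
            simp only [h1]
            rw [lintegral_exp_inner_stdGaussian]
            refine ENNReal.ofReal_le_ofReal (Real.exp_le_exp.2 ?_)
            rw [norm_smul, Real.norm_of_nonneg (by positivity)]
            have := mul_le_mul_of_nonneg_left (hB u hu) (by positivity : 0 ≤ Real.pi ^ 2 / 8)
            linarith
          · simp [hF, hu]
      _ = _ := by simp
  have hpt : ∀ z ∈ S ×ˢ S, ENNReal.ofReal (Real.exp (f z.2 - f z.1)) ≤
      ENNReal.ofReal (2 / Real.pi) * ∫⁻ θ in Set.Ioc 0 (Real.pi / 2), F (R θ z) := by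
    rintro ⟨x, y⟩ ⟨hx, hy⟩
    refine (ENNReal.ofReal_le_ofReal (exp_sub_le_integral_rotation hg hf x y)).trans ?_
    rw [ENNReal.ofReal_mul (by positivity)]
    refine mul_le_mul_right ?_ _
    have hc : Continuous fun θ : ℝ => Real.exp (Real.pi / 2 *
        ⟪g (Real.cos θ • x + Real.sin θ • y), -Real.sin θ • x + Real.cos θ • y⟫_ℝ) := by
      refine Real.continuous_exp.comp (continuous_const.mul (Continuous.inner (hg.comp ?_) ?_))
        <;> fun_prop
    rw [ofReal_integral_eq_lintegral_ofReal hc.integrableOn_Ioc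
      (ae_of_all _ fun _ => (Real.exp_pos _).le)]
    refine lintegral_mono fun θ => ?_
    simp only [hF, hR]
    rw [Set.indicator_of_mem (hSS' x hx y hy θ)]
  calc ∫⁻ z in S ×ˢ S, ENNReal.ofReal (Real.exp (f z.2 - f z.1)) ∂(γ.prod γ)
      ≤ ∫⁻ z in S ×ˢ S, ENNReal.ofReal (2 / Real.pi) *
          (∫⁻ θ in Set.Ioc 0 (Real.pi / 2), F (R θ z)) ∂(γ.prod γ) :=
        setLIntegral_mono' (hS.prod hS) hpt
    _ ≤ ∫⁻ z, ENNReal.ofReal (2 / Real.pi) *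
          (∫⁻ θ in Set.Ioc 0 (Real.pi / 2), F (R θ z)) ∂(γ.prod γ) :=
        setLIntegral_le_lintegral _ _
    _ = ENNReal.ofReal (2 / Real.pi) * ∫⁻ θ in Set.Ioc 0 (Real.pi / 2),
          (∫⁻ z, F (R θ z) ∂(γ.prod γ)) := by
        have hm : Measurable fun z => ∫⁻ θ in Set.Ioc 0 (Real.pi / 2), F (R θ z) :=
          Measurable.lintegral_prod_right' (hFm.comp hRm)
        rw [lintegral_const_mul _ hm,
          lintegral_lintegral_swap (f := fun z θ => F (R θ z)) (hFm.comp hRm).aemeasurable]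
    _ ≤ ENNReal.ofReal (2 / Real.pi) * ∫⁻ θ in Set.Ioc 0 (Real.pi / 2),
          ENNReal.ofReal (Real.exp (Real.pi ^ 2 / 8 * B)) := by
        gcongr with θ
        rw [hrot θ]; exact hFle
    _ = ENNReal.ofReal (Real.exp (Real.pi ^ 2 / 8 * B)) := by
        rw [setLIntegral_const, Real.volume_Ioc, sub_zero, mul_comm (ENNReal.ofReal _)
          (ENNReal.ofReal (Real.pi / 2)), ← mul_assoc, ← ENNReal.ofReal_mul (by positivity),
          div_mul_div_cancel₀ hpi.ne']
        simp

/-- Chernoff's bound for a function with mean zero on `S` whose gradient is controlled near `S`: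
the factor `exp (-f)` in the Maurey–Pisier inequality integrates to at least the measure
of `S`, because `exp (-f) ≥ 1 - f`. -/
theorem stdGaussian_real_inter_le_of_gradient_le {f : E → ℝ} {g : E → E} (hg : Continuous g)
    (hf : ∀ x, HasFDerivAt f (innerSL ℝ (g x)) x) {S S' : Set E} (hS : MeasurableSet S)
    (hS' : MeasurableSet S')
    (hSS' : ∀ x ∈ S, ∀ y ∈ S, ∀ θ : ℝ, Real.cos θ • x + Real.sin θ • y ∈ S')
    {B : ℝ} (hB : ∀ x ∈ S', ‖g x‖ ^ 2 ≤ B)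
    (hint : IntegrableOn f S (stdGaussian E)) (hmean : ∫ x in S, f x ∂(stdGaussian E) = 0)
    (t : ℝ) :
    (stdGaussian E).real S * (stdGaussian E).real (S ∩ {x | t < f x}) ≤
      Real.exp (Real.pi ^ 2 / 8 * B - t) := by
  have hfc : Continuous f := continuous_iff_continuousAt.2 fun x => (hf x).continuousAt
  have hMP := lintegral_exp_sub_le_of_gradient_le hg hf hS hS' hSS' hB
  set γ := stdGaussian E
  have hT : MeasurableSet (S ∩ {x | t < f x}) :=
    hS.inter (measurableSet_lt measurable_const hfc.measurable)
  have h1 : ENNReal.ofReal (γ.real S)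
      ≤ ∫⁻ x in S, ENNReal.ofReal (Real.exp (- f x)) ∂γ := by
    calc ENNReal.ofReal (γ.real S) = ENNReal.ofReal (∫ x in S, (1 - f x) ∂γ) := by
          rw [integral_sub (by simp) hint, hmean]; simp [Measure.real]
      _ ≤ ENNReal.ofReal (∫ x in S, max (1 - f x) 0 ∂γ) := by
          have hi : IntegrableOn (fun x => 1 - f x) S γ := (integrable_const 1).sub hint
          exact ENNReal.ofReal_le_ofReal
            (integral_mono hi hi.pos_part fun x => le_max_left _ _)
      _ = ∫⁻ x in S, ENNReal.ofReal (max (1 - f x) 0) ∂γ := by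
          have hi : IntegrableOn (fun x => 1 - f x) S γ := (integrable_const 1).sub hint
          exact ofReal_integral_eq_lintegral_ofReal hi.pos_part
            (ae_of_all _ fun x => le_max_right _ _)
      _ ≤ _ := by
          refine lintegral_mono fun x => ENNReal.ofReal_le_ofReal ?_
          have := Real.add_one_le_exp (-f x)
          exact max_le (by linarith) (Real.exp_pos _).le
  have h2 : ENNReal.ofReal (Real.exp t) * ENNReal.ofReal (γ.real (S ∩ {x | t < f x}))
      ≤ ∫⁻ x in S, ENNReal.ofReal (Real.exp (f x)) ∂γ := by
    rw [Measure.real, ENNReal.ofReal_toReal (measure_ne_top _ _), ← setLIntegral_const]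
    refine (setLIntegral_mono' hT fun x hx => ?_).trans
      (lintegral_mono_set Set.inter_subset_left)
    exact ENNReal.ofReal_le_ofReal (Real.exp_le_exp.2 hx.2.le)
  have h3 : (∫⁻ x in S, ENNReal.ofReal (Real.exp (- f x)) ∂γ) *
      (∫⁻ x in S, ENNReal.ofReal (Real.exp (f x)) ∂γ)
      = ∫⁻ z in S ×ˢ S, ENNReal.ofReal (Real.exp (f z.2 - f z.1)) ∂(γ.prod γ) := by
    rw [← Measure.prod_restrict, ← lintegral_prod_mul (by fun_prop) (by fun_prop)]
    refine lintegral_congr fun z => ?_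
    rw [← ENNReal.ofReal_mul (Real.exp_pos _).le, ← Real.exp_add]
    congr 2; ring
  have h4 := (mul_le_mul' h1 h2).trans (h3.le.trans hMP)
  rw [← ENNReal.ofReal_mul (Real.exp_pos _).le, ← ENNReal.ofReal_mul measureReal_nonneg,
    ENNReal.ofReal_le_ofReal_iff (Real.exp_pos _).le] at h4
  rw [Real.exp_sub, le_div_iff₀ (Real.exp_pos _)]
  linarith

/-- The previous bound for `lam * f` with the optimal `lam`. -/
theorem stdGaussian_real_inter_le_exp_neg_sq {f : E → ℝ} {g : E → E} (hg : Continuous g)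
    (hf : ∀ x, HasFDerivAt f (innerSL ℝ (g x)) x) {S S' : Set E} (hS : MeasurableSet S)
    (hS' : MeasurableSet S')
    (hSS' : ∀ x ∈ S, ∀ y ∈ S, ∀ θ : ℝ, Real.cos θ • x + Real.sin θ • y ∈ S')
    {B : ℝ} (hB0 : 0 < B) (hB : ∀ x ∈ S', ‖g x‖ ^ 2 ≤ B)
    (hint : IntegrableOn f S (stdGaussian E)) (hmean : ∫ x in S, f x ∂(stdGaussian E) = 0)
    (hhalf : 1 / 2 ≤ (stdGaussian E).real S) {t : ℝ} (ht : 0 < t) :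
    (stdGaussian E).real (S ∩ {x | t < f x}) ≤
      2 * Real.exp (-(2 * t ^ 2 / (Real.pi ^ 2 * B))) := by
  set lam : ℝ := 4 * t / (Real.pi ^ 2 * B) with hlam
  have hpi := Real.pi_pos
  have hlam0 : 0 < lam := by positivity
  have hmain := stdGaussian_real_inter_le_of_gradient_le
    (f := fun z => lam * f z) (g := fun z => lam • g z) (hg.const_smul lam)
    (fun z => by simpa using (hf z).const_mul lam) hS hS' hSS' (B := lam ^ 2 * B)
    (fun z hz => by
      rw [norm_smul, mul_pow, Real.norm_eq_abs, sq_abs]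
      exact mul_le_mul_of_nonneg_left (hB z hz) (sq_nonneg _))
    (hint.const_mul lam) (by rw [integral_const_mul, hmean, mul_zero]) (lam * t)
  have hset : {z | lam * t < lam * f z} = {z | t < f z} := by
    ext z; exact mul_lt_mul_iff_right₀ hlam0
  have hexp : Real.pi ^ 2 / 8 * (lam ^ 2 * B) - lam * t = -(2 * t ^ 2 / (Real.pi ^ 2 * B)) := by
    rw [hlam]; field_simp; ring
  rw [hset, hexp] at hmain
  have h0 := measureReal_nonneg (μ := stdGaussian E) (s := S ∩ {z | t < f z})
  nlinarith

end GaussianConcentration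

/-! ### A continuously differentiable soft threshold -/

section SmoothThreshold

/-- The piecewise linear ramp in `|x|` that vanishes for `|x| ≤ T` and equals `1` for
`|x| ≥ T + ε`. -/
noncomputable def ramp (T ε x : ℝ) : ℝ := max 0 (min 1 ((|x| - T) / ε))

/-- The primitive of `ramp T ε` vanishing at `0`: a continuously differentiable version of
soft thresholding at level `T`. -/
noncomputable def smoothThreshold (T ε x : ℝ) : ℝ := ∫ u in (0:ℝ)..x, ramp T ε u

variable {T ε : ℝ}

lemma continuous_ramp : Continuous (ramp T ε) := by
  unfold ramp; fun_prop

lemma ramp_nonneg (x : ℝ) : 0 ≤ ramp T ε x := le_max_left _ _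

lemma ramp_le_one (x : ℝ) : ramp T ε x ≤ 1 := max_le zero_le_one (min_le_left _ _)

lemma ramp_neg (x : ℝ) : ramp T ε (-x) = ramp T ε x := by simp [ramp]

lemma ramp_eq_zero (hε : 0 < ε) {x : ℝ} (hx : |x| ≤ T) : ramp T ε x = 0 :=
  max_eq_left ((min_le_right _ _).trans (div_nonpos_of_nonpos_of_nonneg (by linarith) hε.le))

lemma ramp_eq_one (hε : 0 < ε) {x : ℝ} (hx : T + ε ≤ |x|) : ramp T ε x = 1 := by
  have : 1 ≤ (|x| - T) / ε := by rw [le_div_iff₀ hε]; linarith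
  simp [ramp, this]

lemma sq_ramp_mul_le (hε : 0 < ε) (hT : 0 ≤ T) (x : ℝ) : ramp T ε x ^ 2 * T ^ 2 ≤ x ^ 2 := by
  rcases le_or_gt |x| T with h | h
  · rw [ramp_eq_zero hε h]; simpa using sq_nonneg x
  · have h1 : ramp T ε x ^ 2 ≤ 1 := pow_le_one₀ (ramp_nonneg x) (ramp_le_one x)
    have h2 : T ^ 2 ≤ x ^ 2 := by rw [← sq_abs x]; gcongr
    nlinarith [sq_nonneg T]

lemma hasDerivAt_smoothThreshold (x : ℝ) :
    HasDerivAt (smoothThreshold T ε) (ramp T ε x) x :=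
  intervalIntegral.integral_hasDerivAt_right (continuous_ramp.intervalIntegrable _ _)
    (continuous_ramp.stronglyMeasurableAtFilter _ _) continuous_ramp.continuousAt

lemma continuous_smoothThreshold : Continuous (smoothThreshold T ε) :=
  continuous_iff_continuousAt.2 fun x => (hasDerivAt_smoothThreshold x).continuousAt

lemma smoothThreshold_neg (x : ℝ) : smoothThreshold T ε (-x) = -smoothThreshold T ε x := by
  have h := intervalIntegral.integral_comp_neg (a := 0) (b := x) (ramp T ε)
  simp only [ramp_neg, neg_zero] at h
  rw [smoothThreshold, smoothThreshold, h, intervalIntegral.integral_symm]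

lemma softThreshold_neg (t x : ℝ) : softThreshold t (-x) = -softThreshold t x := by
  simp [softThreshold, Real.sign_neg]

lemma softThreshold_of_nonneg {t x : ℝ} (ht : 0 ≤ t) (hx : 0 ≤ x) :
    softThreshold t x = max (x - t) 0 := by
  rcases hx.eq_or_lt with rfl | h
  · simp [softThreshold, ht]
  · simp [softThreshold, Real.sign_of_pos h, abs_of_pos h]

lemma abs_smoothThreshold_sub_le (hε : 0 < ε) (hT : 0 ≤ T) (x : ℝ) :
    |smoothThreshold T ε x - softThreshold T x| ≤ ε := by
  have hi : ∀ a b : ℝ, IntervalIntegrable (ramp T ε) volume a b :=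
    fun a b => continuous_ramp.intervalIntegrable a b
  have key : ∀ x : ℝ, 0 ≤ x → |smoothThreshold T ε x - softThreshold T x| ≤ ε := by
    intro x hx
    rw [softThreshold_of_nonneg hT hx]
    have hzero : ∀ y, 0 ≤ y → y ≤ T → smoothThreshold T ε y = 0 := by
      intro y hy hyT
      have : ∫ u in (0:ℝ)..y, ramp T ε u = ∫ u in (0:ℝ)..y, (0:ℝ) := by
        refine intervalIntegral.integral_congr fun u hu => ?_
        rw [Set.uIcc_of_le hy] at hu
        exact ramp_eq_zero hε (by rw [abs_of_nonneg hu.1]; linarith [hu.2])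
      simpa [smoothThreshold] using this
    rcases le_or_gt x T with h | h
    · rw [hzero x hx h, max_eq_right (by linarith)]; simpa using hε.le
    · rw [max_eq_left (by linarith)]
      have hsplit : smoothThreshold T ε x = ∫ u in T..x, ramp T ε u := by
        have := intervalIntegral.integral_add_adjacent_intervals (hi 0 T) (hi T x)
        have h0 := hzero T hT le_rfl
        unfold smoothThreshold at h0 ⊢
        linarith
      have hup : ∫ u in T..x, ramp T ε u ≤ x - T := by
        have := intervalIntegral.integral_mono_on h.le (hi T x)
          (intervalIntegrable_const (c := (1:ℝ))) fun u _ => ramp_le_one u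
        simpa using this
      have hlow : x - T - ε ≤ ∫ u in T..x, ramp T ε u := by
        rcases le_or_gt x (T + ε) with h' | h'
        · have : 0 ≤ ∫ u in T..x, ramp T ε u :=
            intervalIntegral.integral_nonneg h.le fun u _ => ramp_nonneg u
          linarith
        · have h1 := intervalIntegral.integral_add_adjacent_intervals (hi T (T + ε))
            (hi (T + ε) x)
          have h2 : 0 ≤ ∫ u in T..(T + ε), ramp T ε u :=
            intervalIntegral.integral_nonneg (by linarith) fun u _ => ramp_nonneg u
          have h3 : ∫ u in (T + ε)..x, ramp T ε u = ∫ u in (T + ε)..x, (1:ℝ) := by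
            refine intervalIntegral.integral_congr fun u hu => ?_
            rw [Set.uIcc_of_le h'.le] at hu
            exact ramp_eq_one hε (hu.1.trans (le_abs_self u))
          simp at h3
          linarith
      rw [hsplit, abs_le]
      constructor <;> linarith
  rcases le_total 0 x with h | h
  · exact key x h
  · have := key (-x) (by linarith)
    rwa [smoothThreshold_neg, softThreshold_neg, neg_sub_neg, abs_sub_comm] at this

end SmoothThreshold

/-! ### Thresholded Gram forms of a Gaussian family of columns -/

section GramForm

open scoped InnerProductSpace ENNReal

variable {ι κ : Type*} [Fintype ι] [Fintype κ]

/-- Families `z` of vectors of `ℝ^κ` indexed by `ι`, with the Hilbert–Schmidt norm: the columns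
of a `κ × ι` matrix. -/
abbrev Columns (ι κ : Type*) [Fintype ι] [Fintype κ] : Type _ :=
  PiLp 2 fun _ : ι => EuclideanSpace ℝ κ

/-- The families of columns whose matrix has squared operator norm at most `R`. -/
def boundedColumns (ι κ : Type*) [Fintype ι] [Fintype κ] (R : ℝ) : Set (Columns ι κ) :=
  {z | ∀ x : ι → ℝ, ‖∑ j, x j • z j‖ ^ 2 ≤ R * ∑ j, x j ^ 2}

lemma isClosed_boundedColumns (R : ℝ) : IsClosed (boundedColumns ι κ R) := by
  simp only [boundedColumns, Set.ofPred_forall]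
  refine isClosed_iInter fun x => isClosed_le ?_ continuous_const
  fun_prop

lemma norm_sq_le_of_mem_boundedColumns {R : ℝ} {z : Columns ι κ}
    (hz : z ∈ boundedColumns ι κ R) (i : ι) : ‖z i‖ ^ 2 ≤ R := by
  classical
  simpa [Pi.single_apply] using hz (Pi.single i 1)

lemma isCompact_boundedColumns (R : ℝ) : IsCompact (boundedColumns ι κ R) := by
  refine Metric.isCompact_of_isClosed_isBounded (isClosed_boundedColumns R) ?_
  refine (Metric.isBounded_iff_subset_closedBall 0).2 ⟨√(∑ _i : ι, R), fun z hz => ?_⟩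
  rw [mem_closedBall_zero_iff, PiLp.norm_eq_of_L2]
  exact Real.sqrt_le_sqrt (Finset.sum_le_sum fun i _ => norm_sq_le_of_mem_boundedColumns hz i)

lemma cos_smul_add_sin_smul_mem_boundedColumns {R : ℝ} {y z : Columns ι κ}
    (hy : y ∈ boundedColumns ι κ R) (hz : z ∈ boundedColumns ι κ R) (θ : ℝ) :
    Real.cos θ • y + Real.sin θ • z ∈ boundedColumns ι κ (2 * R) := by
  intro x
  have h : ∑ j, x j • (Real.cos θ • y + Real.sin θ • z) j
      = Real.cos θ • ∑ j, x j • y j + Real.sin θ • ∑ j, x j • z j := by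
    simp only [PiLp.add_apply, PiLp.smul_apply, smul_add, Finset.sum_add_distrib,
      Finset.smul_sum, smul_comm (Real.cos θ) (x _), smul_comm (Real.sin θ) (x _)]
  have h1 := hy x
  have h2 := hz x
  rw [h]
  set u := ∑ j, x j • y j
  set v := ∑ j, x j • z j
  have h3 : ‖Real.cos θ • u + Real.sin θ • v‖ ≤ |Real.cos θ| * ‖u‖ + |Real.sin θ| * ‖v‖ := by
    refine (norm_add_le _ _).trans ?_
    rw [norm_smul, norm_smul, Real.norm_eq_abs, Real.norm_eq_abs]
  have h4 : (|Real.cos θ| * ‖u‖ + |Real.sin θ| * ‖v‖) ^ 2 ≤ ‖u‖ ^ 2 + ‖v‖ ^ 2 := by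
    have h5 : |Real.cos θ| ^ 2 + |Real.sin θ| ^ 2 = 1 := by
      rw [sq_abs, sq_abs, Real.cos_sq_add_sin_sq]
    nlinarith [sq_nonneg (|Real.cos θ| * ‖v‖ - |Real.sin θ| * ‖u‖)]
  have h6 := pow_le_pow_left₀ (norm_nonneg _) h3 2
  linarith

lemma sum_sq_inner_le_of_mem_boundedColumns {R : ℝ} {z : Columns ι κ}
    (hz : z ∈ boundedColumns ι κ R) (i : ι) : ∑ j, ⟪z i, z j⟫_ℝ ^ 2 ≤ R ^ 2 := by
  set s := ∑ j, ⟪z i, z j⟫_ℝ ^ 2 with hs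
  have hs0 : 0 ≤ s := Finset.sum_nonneg fun j _ => sq_nonneg _
  have h1 : s = ⟪z i, ∑ j, ⟪z i, z j⟫_ℝ • z j⟫_ℝ := by
    rw [inner_sum, hs]
    refine Finset.sum_congr rfl fun j _ => ?_
    rw [real_inner_smul_right]; ring
  have h2 := hz fun j => ⟪z i, z j⟫_ℝ
  have h3 := norm_sq_le_of_mem_boundedColumns hz i
  have hR : 0 ≤ R := (sq_nonneg _).trans h3
  have h4 : s ^ 2 ≤ ‖z i‖ ^ 2 * ‖∑ j, ⟪z i, z j⟫_ℝ • z j‖ ^ 2 := by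
    conv_lhs => rw [h1]
    rw [← mul_pow, ← sq_abs]
    exact pow_le_pow_left₀ (abs_nonneg _) (abs_real_inner_le_norm _ _) 2
  have h5 : s ^ 2 ≤ R * (R * s) :=
    h4.trans (mul_le_mul h3 h2 (sq_nonneg _) hR)
  rcases hs0.eq_or_lt with h | h
  · rw [← h]; positivity
  · nlinarith

/-- The form `∑ c i j * h ⟪z i, z j⟫`, where `h` is the smooth threshold. -/
noncomputable def gramForm (c : ι → ι → ℝ) (T ε : ℝ) (z : Columns ι κ) : ℝ :=
  ∑ i, ∑ j, c i j * smoothThreshold T ε ⟪z i, z j⟫_ℝ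

/-- The gradient of `gramForm c T ε`. -/
noncomputable def gramGradient (c : ι → ι → ℝ) (T ε : ℝ) (z : Columns ι κ) : Columns ι κ :=
  WithLp.toLp 2 fun l => ∑ j, ((c l j + c j l) * ramp T ε ⟪z l, z j⟫_ℝ) • z j

variable {c : ι → ι → ℝ} {T ε : ℝ}

lemma continuous_gramGradient : Continuous (gramGradient (κ := κ) c T ε) := by
  refine (PiLp.continuous_toLp 2 _).comp (continuous_pi fun l => ?_)
  refine continuous_finsetSum _ fun j _ => ?_
  have h : Continuous fun z : Columns ι κ => (c l j + c j l) * ramp T ε ⟪z l, z j⟫_ℝ :=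
    continuous_const.mul (continuous_ramp.comp (by fun_prop))
  fun_prop

lemma hasFDerivAt_gramForm (z : Columns ι κ) :
    HasFDerivAt (gramForm c T ε) (innerSL ℝ (gramGradient c T ε z)) z := by
  have hproj : ∀ i, HasFDerivAt (fun w : Columns ι κ => w i)
      (PiLp.proj 2 (fun _ : ι => EuclideanSpace ℝ κ) i : Columns ι κ →L[ℝ] _) z :=
    fun i => (PiLp.proj 2 (fun _ : ι => EuclideanSpace ℝ κ) i).hasFDerivAt
  have h : ∀ i j, HasFDerivAt (fun w : Columns ι κ => c i j * smoothThreshold T ε ⟪w i, w j⟫_ℝ)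
      _ z := fun i j =>
    ((hasDerivAt_smoothThreshold _).comp_hasFDerivAt z ((hproj i).inner ℝ (hproj j))).const_mul
      (c i j)
  have h2 := HasFDerivAt.fun_sum (u := Finset.univ) fun i _ =>
    HasFDerivAt.fun_sum (u := Finset.univ) fun j _ => h i j
  refine h2.congr_fderiv ?_
  ext H
  have hsymm : ∀ i j, ramp T ε ⟪z i, z j⟫_ℝ = ramp T ε ⟪z j, z i⟫_ℝ :=
    fun i j => by rw [real_inner_comm]
  simp only [_root_.sum_apply, _root_.smul_apply, smul_eq_mul,
    ContinuousLinearMap.comp_apply, ContinuousLinearMap.prod_apply, fderivInnerCLM_apply,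
    PiLp.proj_apply, innerSL_apply_apply]
  have hr : ⟪gramGradient c T ε z, H⟫_ℝ = ∑ l, ∑ j, (c l j + c j l) *
      (ramp T ε ⟪z l, z j⟫_ℝ * ⟪z j, H l⟫_ℝ) := by
    rw [PiLp.inner_apply]
    refine Finset.sum_congr rfl fun l _ => ?_
    change ⟪∑ j, ((c l j + c j l) * ramp T ε ⟪z l, z j⟫_ℝ) • z j, H l⟫_ℝ = _
    simp only [sum_inner, real_inner_smul_left, mul_assoc]
  rw [hr]
  simp only [add_mul, mul_add, Finset.sum_add_distrib]
  rw [add_comm]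
  congr 1
  · refine Finset.sum_congr rfl fun i _ => Finset.sum_congr rfl fun j _ => ?_
    rw [real_inner_comm (z j) (H i)]
  · rw [Finset.sum_comm]
    refine Finset.sum_congr rfl fun i _ => Finset.sum_congr rfl fun j _ => ?_
    rw [hsymm]

lemma norm_sq_gramGradient_le {R : ℝ} {z : Columns ι κ} (hz : z ∈ boundedColumns ι κ R)
    (hR : 0 ≤ R) :
    ‖gramGradient c T ε z‖ ^ 2
      ≤ 4 * R * ∑ i, ∑ j, c i j ^ 2 * ramp T ε ⟪z i, z j⟫_ℝ ^ 2 := by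
  rw [PiLp.norm_sq_eq_of_L2]
  set s := ∑ i, ∑ j, c i j ^ 2 * ramp T ε ⟪z i, z j⟫_ℝ ^ 2 with hs
  have hs' : ∑ i, ∑ j, c j i ^ 2 * ramp T ε ⟪z i, z j⟫_ℝ ^ 2 = s := by
    rw [Finset.sum_comm]
    simp only [hs, real_inner_comm]
  calc ∑ l, ‖gramGradient c T ε z l‖ ^ 2
      ≤ ∑ l, R * ∑ j, ((c l j + c j l) * ramp T ε ⟪z l, z j⟫_ℝ) ^ 2 :=
        Finset.sum_le_sum fun l _ => hz _
    _ ≤ ∑ l, R * ∑ j, (2 * (c l j ^ 2 * ramp T ε ⟪z l, z j⟫_ℝ ^ 2) +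
          2 * (c j l ^ 2 * ramp T ε ⟪z l, z j⟫_ℝ ^ 2)) := by
        gcongr with l _ j _
        have := mul_nonneg (sq_nonneg (c l j - c j l)) (sq_nonneg (ramp T ε ⟪z l, z j⟫_ℝ))
        nlinarith
    _ = 4 * R * s := by
        simp only [Finset.sum_add_distrib, ← Finset.mul_sum, hs']
        ring

lemma norm_sq_gramGradient_le_of_sum_sq_le {R : ℝ} {z : Columns ι κ}
    (hz : z ∈ boundedColumns ι κ R) (hR : 0 ≤ R) (hc : ∑ i, ∑ j, c i j ^ 2 ≤ 1) :
    ‖gramGradient c T ε z‖ ^ 2 ≤ 4 * R := by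
  refine (norm_sq_gramGradient_le hz hR).trans ?_
  have : ∑ i, ∑ j, c i j ^ 2 * ramp T ε ⟪z i, z j⟫_ℝ ^ 2 ≤ 1 := by
    refine le_trans ?_ hc
    gcongr with i _ j _
    exact mul_le_of_le_one_right (sq_nonneg _) (pow_le_one₀ (ramp_nonneg _) (ramp_le_one _))
  nlinarith

/-- If the coefficients are spread out along the second index, in the sense that
`c i j ^ 2 ≤ a i ^ 2 * β` with a small `β`, then the gradient is small: it only sees the entries
above the threshold `T`, of which each row of a Gram matrix bounded by `R` has at most
`(R / T) ^ 2`. -/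
lemma norm_sq_gramGradient_le_of_spread {R : ℝ} {z : Columns ι κ}
    (hz : z ∈ boundedColumns ι κ R) (hR : 0 ≤ R) (hε : 0 < ε) (hT : 0 < T) {a : ι → ℝ} {β : ℝ}
    (ha : ∑ i, a i ^ 2 ≤ 1) (hβ : 0 ≤ β) (hc : ∀ i j, c i j ^ 2 ≤ a i ^ 2 * β) :
    ‖gramGradient c T ε z‖ ^ 2 ≤ 4 * R * (β * (R ^ 2 / T ^ 2)) := by
  refine (norm_sq_gramGradient_le hz hR).trans (mul_le_mul_of_nonneg_left ?_ (by positivity))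
  have hrow : ∀ i, ∑ j, ramp T ε ⟪z i, z j⟫_ℝ ^ 2 ≤ R ^ 2 / T ^ 2 := by
    intro i
    rw [le_div_iff₀ (by positivity), Finset.sum_mul]
    exact (Finset.sum_le_sum fun j _ => sq_ramp_mul_le hε hT.le _).trans
      (sum_sq_inner_le_of_mem_boundedColumns hz i)
  calc ∑ i, ∑ j, c i j ^ 2 * ramp T ε ⟪z i, z j⟫_ℝ ^ 2
      ≤ ∑ i, ∑ j, (a i ^ 2 * β) * ramp T ε ⟪z i, z j⟫_ℝ ^ 2 := by
        gcongr with i _ j _; exact hc i j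
    _ ≤ ∑ i, (a i ^ 2 * β) * (R ^ 2 / T ^ 2) := by
        simp only [← Finset.mul_sum]
        gcongr with i _; exact hrow i
    _ = (∑ i, a i ^ 2) * (β * (R ^ 2 / T ^ 2)) := by
        rw [Finset.sum_mul]; exact Finset.sum_congr rfl fun i _ => by ring
    _ ≤ β * (R ^ 2 / T ^ 2) := mul_le_of_le_one_left (by positivity) ha

/-- Negating one column preserves the Gaussian measure and `boundedColumns`, and changes the sign
of the Gram entries in one row off the diagonal. -/
lemma setIntegral_smoothThreshold_inner_eq_zero {i j : ι} (hij : i ≠ j) (R : ℝ) :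
    ∫ z in boundedColumns ι κ R, smoothThreshold T ε ⟪z i, z j⟫_ℝ
      ∂(stdGaussian (Columns ι κ)) = 0 := by
  classical
  let Φ : Columns ι κ ≃ₗᵢ[ℝ] Columns ι κ := LinearIsometryEquiv.piLpCongrRight 2
    fun l => if l = i then LinearIsometryEquiv.neg ℝ else LinearIsometryEquiv.refl ℝ _
  have hΦ : ∀ z l, Φ z l = (if l = i then (-1 : ℝ) else 1) • z l := by
    intro z l
    by_cases h : l = i <;> simp [Φ, h]
  have hpre : Φ ⁻¹' boundedColumns ι κ R = boundedColumns ι κ R := by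
    have hsub : ∀ z ∈ boundedColumns ι κ R, Φ z ∈ boundedColumns ι κ R := by
      intro z hz x
      have h1 := hz fun l => x l * (if l = i then (-1 : ℝ) else 1)
      have h2 : ∀ l, (if l = i then (-1 : ℝ) else 1) ^ 2 = 1 := fun l => by split_ifs <;> norm_num
      simpa only [hΦ, smul_smul, mul_pow, h2, mul_one] using h1
    refine Set.Subset.antisymm (fun z hz => ?_) hsub
    have h1 := hsub _ hz
    have h2 : Φ (Φ z) = z := by
      ext l : 1
      rw [hΦ, hΦ, smul_smul]
      split_ifs <;> norm_num
    rwa [h2] at h1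
  have hmp : MeasurePreserving Φ (stdGaussian (Columns ι κ)) (stdGaussian (Columns ι κ)) :=
    ⟨Φ.continuous.measurable, stdGaussian_map Φ⟩
  have h := hmp.setIntegral_preimage_emb Φ.toHomeomorph.measurableEmbedding
    (fun z => smoothThreshold T ε ⟪z i, z j⟫_ℝ) (boundedColumns ι κ R)
  rw [hpre] at h
  have h3 : ∀ z, smoothThreshold T ε ⟪Φ z i, Φ z j⟫_ℝ
      = -smoothThreshold T ε ⟪z i, z j⟫_ℝ := by
    intro z
    rw [hΦ, hΦ, ← smoothThreshold_neg]
    simp [hij.symm]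
  simp only [h3, integral_neg] at h
  linarith

lemma continuous_gramForm : Continuous (gramForm (κ := κ) c T ε) :=
  continuous_finsetSum _ fun i _ => continuous_finsetSum _ fun j _ =>
    continuous_const.mul (continuous_smoothThreshold.comp (by fun_prop))

lemma setIntegral_gramForm_eq_zero (hc : ∀ i, c i i = 0) (R : ℝ) :
    ∫ z in boundedColumns ι κ R, gramForm c T ε z ∂(stdGaussian (Columns ι κ)) = 0 := by
  have hint : ∀ i j, IntegrableOn
      (fun z : Columns ι κ => c i j * smoothThreshold T ε ⟪z i, z j⟫_ℝ)
      (boundedColumns ι κ R) (stdGaussian (Columns ι κ)) := fun i j =>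
    ContinuousOn.integrableOn_compact (isCompact_boundedColumns R) (Continuous.continuousOn
      (continuous_const.mul (continuous_smoothThreshold.comp (by fun_prop))))
  unfold gramForm
  rw [integral_finsetSum _ fun i _ => integrable_finsetSum _ fun j _ => hint i j]
  refine Finset.sum_eq_zero fun i _ => ?_
  rw [integral_finsetSum _ fun j _ => hint i j]
  refine Finset.sum_eq_zero fun j _ => ?_
  rcases eq_or_ne i j with rfl | hij
  · simp [hc]
  · rw [integral_const_mul, setIntegral_smoothThreshold_inner_eq_zero hij, mul_zero]

/-- Sub-Gaussian tail of a thresholded Gram form on the event that the columns are bounded. -/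
theorem stdGaussian_real_gramForm_le {R B : ℝ} (hc : ∀ i, c i i = 0)
    (hhalf : 1 / 2 ≤ (stdGaussian (Columns ι κ)).real (boundedColumns ι κ R)) (hB0 : 0 < B)
    (hB : ∀ z ∈ boundedColumns ι κ (2 * R), ‖gramGradient c T ε z‖ ^ 2 ≤ B) {t : ℝ} (ht : 0 < t) :
    (stdGaussian (Columns ι κ)).real (boundedColumns ι κ R ∩ {z | t < gramForm c T ε z})
      ≤ 2 * Real.exp (-(2 * t ^ 2 / (Real.pi ^ 2 * B))) := by
  exact stdGaussian_real_inter_le_exp_neg_sq (E := Columns ι κ) (f := gramForm c T ε)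
    (g := gramGradient c T ε) continuous_gramGradient hasFDerivAt_gramForm
    (isClosed_boundedColumns R).measurableSet (isClosed_boundedColumns (2 * R)).measurableSet
    (fun x hx y hy θ => cos_smul_add_sin_smul_mem_boundedColumns hx hy θ) hB0 hB
    (continuous_gramForm.continuousOn.integrableOn_compact (isCompact_boundedColumns R))
    (setIntegral_gramForm_eq_zero hc R) hhalf ht

end GramForm

/-! ### A lattice net of the unit ball -/

section LatticeNet

open scoped InnerProductSpace

variable {ι : Type*} [Fintype ι]

open Classical in
/-- The integer vectors `k` with `∑ i, k i ^ 2 ≤ 16 * card ι`, that is, those for which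
`netPoint k` lies in the unit ball. The bound on the single entries follows from that on the sum
and only serves to present the set as a finite one. -/
noncomputable def latticeNet (ι : Type*) [Fintype ι] : Finset (ι → ℤ) :=
  (Fintype.piFinset fun _ : ι =>
    Finset.Icc (-(16 * Fintype.card ι : ℤ)) (16 * Fintype.card ι)).filter
      fun k => ∑ i, k i ^ 2 ≤ 16 * (Fintype.card ι : ℤ)

/-- The point `k / (4 √(card ι))` of the rescaled integer lattice. -/
noncomputable def netPoint (k : ι → ℤ) : EuclideanSpace ℝ ι :=
  WithLp.toLp 2 fun i => (k i : ℝ) / (4 * √(Fintype.card ι))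

lemma mem_latticeNet {k : ι → ℤ} :
    k ∈ latticeNet ι ↔ ∑ i, k i ^ 2 ≤ 16 * (Fintype.card ι : ℤ) := by
  classical
  simp only [latticeNet, Finset.mem_filter, Fintype.mem_piFinset, Finset.mem_Icc,
    and_iff_right_iff_imp]
  intro h i
  have h1 : k i ^ 2 ≤ ∑ i, k i ^ 2 :=
    Finset.single_le_sum (fun i _ => sq_nonneg (k i)) (Finset.mem_univ i)
  constructor <;> nlinarith

lemma sum_sq_le_of_mem_latticeNet {k : ι → ℤ} (hk : k ∈ latticeNet ι) :
    ∑ i, (k i : ℝ) ^ 2 ≤ 16 * Fintype.card ι := by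
  exact_mod_cast mem_latticeNet.1 hk

lemma netPoint_sq [Nonempty ι] (k : ι → ℤ) (i : ι) :
    netPoint k i ^ 2 = (k i : ℝ) ^ 2 / (16 * Fintype.card ι) := by
  simp only [netPoint]
  rw [div_pow, mul_pow, Real.sq_sqrt (by positivity)]
  norm_num

lemma sum_sq_netPoint_le_one [Nonempty ι] {k : ι → ℤ} (hk : k ∈ latticeNet ι) :
    ∑ i, netPoint k i ^ 2 ≤ 1 := by
  simp only [netPoint_sq, ← Finset.sum_div]
  have : (0 : ℝ) < Fintype.card ι := by exact_mod_cast Fintype.card_pos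
  exact div_le_one_of_le₀ (sum_sq_le_of_mem_latticeNet hk) (by positivity)

lemma norm_netPoint_le_one [Nonempty ι] {k : ι → ℤ} (hk : k ∈ latticeNet ι) :
    ‖netPoint k‖ ≤ 1 := by
  rw [EuclideanSpace.norm_eq, Real.sqrt_le_one]
  simpa using sum_sq_netPoint_le_one hk

/-- Rounding a real number towards zero. -/
lemma exists_int_sq_le_sq (y : ℝ) : ∃ k : ℤ, (k : ℝ) ^ 2 ≤ y ^ 2 ∧ (y - k) ^ 2 ≤ 1 := by
  rcases le_total 0 y with h | h
  · have h1 := Int.floor_le y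
    have h2 := Int.lt_floor_add_one y
    have h3 : (0 : ℝ) ≤ ⌊y⌋ := by exact_mod_cast Int.floor_nonneg.2 h
    exact ⟨⌊y⌋, by nlinarith, by nlinarith⟩
  · have h1 := Int.le_ceil y
    have h2 := Int.ceil_lt_add_one y
    have h3 : (⌈y⌉ : ℝ) ≤ 0 := by exact_mod_cast Int.ceil_le.2 (by simpa using h)
    exact ⟨⌈y⌉, by nlinarith, by nlinarith⟩

lemma exists_mem_latticeNet_norm_sub_le [Nonempty ι] {x : EuclideanSpace ℝ ι} (hx : ‖x‖ ≤ 1) :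
    ∃ k ∈ latticeNet ι, ‖x - netPoint k‖ ≤ 1 / 4 := by
  have hp : (0 : ℝ) < Fintype.card ι := by exact_mod_cast Fintype.card_pos
  set q := 4 * √(Fintype.card ι : ℝ) with hq
  have hq0 : 0 < q := by positivity
  have hq2 : q ^ 2 = 16 * Fintype.card ι := by
    rw [hq, mul_pow, Real.sq_sqrt hp.le]; norm_num
  choose k hk1 hk2 using fun i => exists_int_sq_le_sq (q * x i)
  have hx1 : ∑ i, x i ^ 2 ≤ 1 := by
    rw [← EuclideanSpace.real_norm_sq_eq]; exact pow_le_one₀ (norm_nonneg _) hx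
  refine ⟨k, mem_latticeNet.2 ?_, ?_⟩
  · have : ∑ i, (k i : ℝ) ^ 2 ≤ 16 * Fintype.card ι := by
      calc ∑ i, (k i : ℝ) ^ 2 ≤ ∑ i, q ^ 2 * x i ^ 2 :=
            Finset.sum_le_sum fun i _ => (hk1 i).trans_eq (mul_pow _ _ _)
        _ = q ^ 2 * ∑ i, x i ^ 2 := by rw [Finset.mul_sum]
        _ ≤ 16 * Fintype.card ι := by rw [← hq2]; exact mul_le_of_le_one_right (by positivity) hx1
    exact_mod_cast this
  · have h1 : ‖x - netPoint k‖ ^ 2 ≤ (1 / 4) ^ 2 := by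
      rw [EuclideanSpace.real_norm_sq_eq]
      calc ∑ i, (x - netPoint k) i ^ 2 = ∑ i, (q * x i - k i) ^ 2 / q ^ 2 := by
            refine Finset.sum_congr rfl fun i _ => ?_
            have : (x - netPoint k) i = x i - k i / q := rfl
            rw [this]; field_simp
        _ ≤ ∑ _i : ι, 1 / q ^ 2 := by gcongr with i _; exact hk2 i
        _ = (1 / 4) ^ 2 := by
            rw [Finset.sum_const, Finset.card_univ, nsmul_eq_mul, hq2]; field_simp; norm_num
    exact le_of_sq_le_sq h1 (by norm_num)

lemma opNorm_le_of_forall_netPoint [Nonempty ι] {F : Type*} [NormedAddCommGroup F]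
    [NormedSpace ℝ F] (L : EuclideanSpace ℝ ι →L[ℝ] F) {C : ℝ} (hC : 0 ≤ C)
    (h : ∀ k ∈ latticeNet ι, ‖L (netPoint k)‖ ≤ C) : ‖L‖ ≤ 4 / 3 * C := by
  have h1 : ‖L‖ ≤ C + 1 / 4 * ‖L‖ := by
    refine ContinuousLinearMap.opNorm_le_of_unit_norm (by positivity) fun x hx => ?_
    obtain ⟨k, hk, hxk⟩ := exists_mem_latticeNet_norm_sub_le hx.le
    calc ‖L x‖ = ‖L (netPoint k) + L (x - netPoint k)‖ := by rw [← map_add]; congr 2; abel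
      _ ≤ ‖L (netPoint k)‖ + ‖L‖ * ‖x - netPoint k‖ :=
          (norm_add_le _ _).trans (add_le_add_right (L.le_opNorm _) _)
      _ ≤ C + 1 / 4 * ‖L‖ := by
          rw [mul_comm (1 / 4 : ℝ)]
          exact add_le_add (h k hk) (mul_le_mul_of_nonneg_left hxk (norm_nonneg _))
  linarith

lemma opNorm_le_of_forall_inner_netPoint [Nonempty ι]
    (M : EuclideanSpace ℝ ι →L[ℝ] EuclideanSpace ℝ ι) {C : ℝ} (hC : 0 ≤ C)
    (h : ∀ k ∈ latticeNet ι, ∀ l ∈ latticeNet ι, ⟪netPoint k, M (netPoint l)⟫_ℝ ≤ C) :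
    ‖M‖ ≤ 2 * C := by
  have h1 : ‖M‖ ≤ C + 1 / 2 * ‖M‖ := by
    refine ContinuousLinearMap.opNorm_le_of_unit_norm (by positivity) fun y hy => ?_
    by_cases hMy : M y = 0
    · rw [hMy, norm_zero]; positivity
    set x := ‖M y‖⁻¹ • M y with hx
    have hMy0 : 0 < ‖M y‖ := norm_pos_iff.2 hMy
    have hx1 : ‖x‖ = 1 := by
      rw [hx, norm_smul, norm_inv, norm_norm, inv_mul_cancel₀ hMy0.ne']
    have hxy : ⟪x, M y⟫_ℝ = ‖M y‖ := by
      rw [hx, real_inner_smul_left, real_inner_self_eq_norm_sq]; field_simp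
    obtain ⟨k, hk, hxk⟩ := exists_mem_latticeNet_norm_sub_le hx1.le
    obtain ⟨l, hl, hyl⟩ := exists_mem_latticeNet_norm_sub_le hy.le
    have hsplit : ⟪x, M y⟫_ℝ = ⟪netPoint k, M (netPoint l)⟫_ℝ + ⟪x - netPoint k, M y⟫_ℝ
        + ⟪netPoint k, M (y - netPoint l)⟫_ℝ := by
      rw [map_sub, inner_sub_left, inner_sub_right]; ring
    have h2 : ⟪x - netPoint k, M y⟫_ℝ ≤ 1 / 4 * ‖M‖ := by
      refine (real_inner_le_norm _ _).trans (mul_le_mul hxk ?_ (norm_nonneg _) (by norm_num))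
      simpa [hy] using M.le_opNorm y
    have h3 : ⟪netPoint k, M (y - netPoint l)⟫_ℝ ≤ 1 * (‖M‖ * (1 / 4)) := by
      refine (real_inner_le_norm _ _).trans
        (mul_le_mul (norm_netPoint_le_one hk) ?_ (norm_nonneg _) zero_le_one)
      exact (M.le_opNorm _).trans (mul_le_mul_of_nonneg_left hyl (norm_nonneg _))
    have := h k hk l hl
    linarith
  linarith

/-! ### Cardinality of the net -/

/-- Exponential weights bound the number of integer vectors in an `ℓ¹` ball. -/
lemma card_le_exp_mul_pow (F : Finset (ι → ℤ)) (V : Finset ℤ) {s R : ℝ} (hs : 0 ≤ s)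
    (hV : ∀ k ∈ F, ∀ i, k i ∈ V) (hR : ∀ k ∈ F, ∑ i, |(k i : ℝ)| ≤ R) :
    (F.card : ℝ) ≤ Real.exp (s * R) * (∑ v ∈ V, Real.exp (-s * |(v : ℝ)|)) ^ Fintype.card ι := by
  classical
  have hsub : F ⊆ Fintype.piFinset fun _ => V := fun k hk => Fintype.mem_piFinset.2 (hV k hk)
  calc (F.card : ℝ) = ∑ _k ∈ F, (1 : ℝ) := by simp
    _ ≤ ∑ k ∈ F, Real.exp (s * R) * ∏ i, Real.exp (-s * |(k i : ℝ)|) := by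
        refine Finset.sum_le_sum fun k hk => ?_
        rw [← Real.exp_sum, ← Real.exp_add, ← Finset.mul_sum]
        refine Real.one_le_exp ?_
        nlinarith [hR k hk]
    _ ≤ ∑ k ∈ Fintype.piFinset fun _ => V,
          Real.exp (s * R) * ∏ i, Real.exp (-s * |(k i : ℝ)|) :=
        Finset.sum_le_sum_of_subset_of_nonneg hsub fun k _ _ => by positivity
    _ = _ := by
        rw [← Finset.mul_sum, Finset.sum_prod_piFinset V fun _ v => Real.exp (-s * |(v : ℝ)|),
          Finset.prod_const, Finset.card_univ]

lemma sum_exp_neg_mul_abs_le (V : Finset ℤ) {s : ℝ} (hs : 0 < s) {m : ℕ}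
    (hV : ∀ v ∈ V, v ≠ 0 → (m : ℤ) ≤ |v|) :
    ∑ v ∈ V, Real.exp (-s * |(v : ℝ)|)
      ≤ 1 + 2 * (Real.exp (-s * m) / (1 - Real.exp (-s))) := by
  classical
  obtain ⟨M, hM⟩ : ∃ M : ℕ, ∀ v ∈ V, v.natAbs < M :=
    ⟨V.sup Int.natAbs + 1, fun v hv => Nat.lt_succ_of_le (Finset.le_sup (f := Int.natAbs) hv)⟩
  set w : ℤ → ℝ := fun v => Real.exp (-s * |(v : ℝ)|) with hw
  set A : Finset ℤ := (Finset.Ico m M).image fun a : ℕ => (a : ℤ) with hA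
  set B : Finset ℤ := (Finset.Ico m M).image fun a : ℕ => -(a : ℤ) with hB
  have hr : Real.exp (-s) < 1 := by simpa using hs
  have hgeom : ∑ a ∈ Finset.Ico m M, Real.exp (-s * (a : ℝ))
      ≤ Real.exp (-s * m) / (1 - Real.exp (-s)) := by
    have h := geom_sum_Ico_le_of_lt_one (m := m) (n := M) (Real.exp_pos (-s)).le hr
    simpa only [← Real.exp_nat_mul, mul_comm (_ : ℝ) (-s)] using h
  have hAs : ∑ v ∈ A, w v = ∑ a ∈ Finset.Ico m M, Real.exp (-s * (a : ℝ)) := by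
    rw [hA, Finset.sum_image (fun a _ b _ h => by exact_mod_cast h)]
    simp [hw]
  have hBs : ∑ v ∈ B, w v = ∑ a ∈ Finset.Ico m M, Real.exp (-s * (a : ℝ)) := by
    rw [hB, Finset.sum_image (fun a _ b _ h => by simpa using h)]
    simp [hw]
  have hsub : V ⊆ {0} ∪ (A ∪ B) := by
    intro v hv
    rcases eq_or_ne v 0 with rfl | h0
    · simp
    have h1 := hV v hv h0
    rw [Int.abs_eq_natAbs] at h1
    have h2 := hM v hv
    have h3 : v.natAbs ∈ Finset.Ico m M := by
      rw [Finset.mem_Ico]; exact ⟨by omega, h2⟩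
    refine Finset.mem_union_right _ ?_
    rcases Int.natAbs_eq v with h | h
    · exact Finset.mem_union_left _ (Finset.mem_image.2 ⟨_, h3, h.symm⟩)
    · exact Finset.mem_union_right _ (Finset.mem_image.2 ⟨_, h3, h.symm⟩)
  have hunion : ∀ X Y : Finset ℤ, ∑ v ∈ X ∪ Y, w v ≤ ∑ v ∈ X, w v + ∑ v ∈ Y, w v := by
    intro X Y
    rw [← Finset.sum_union_inter]
    exact le_add_of_nonneg_right (Finset.sum_nonneg fun v _ => (Real.exp_pos _).le)
  calc ∑ v ∈ V, w v ≤ ∑ v ∈ {0} ∪ (A ∪ B), w v :=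
        Finset.sum_le_sum_of_subset_of_nonneg hsub fun v _ _ => (Real.exp_pos _).le
    _ ≤ ∑ v ∈ {0}, w v + (∑ v ∈ A, w v + ∑ v ∈ B, w v) :=
        (hunion _ _).trans (add_le_add_right (hunion _ _) _)
    _ ≤ _ := by
        rw [hAs, hBs]
        simp only [hw, Finset.sum_singleton, Int.cast_zero, abs_zero, mul_zero, Real.exp_zero]
        linarith

/-- With the weight `exp (-|v| / 4)`, each coordinate contributes a factor
`exp 1 * (1 + 2 / (exp (1 / 4) - 1))`, which is below `exp 3.1`. -/
lemma card_latticeNet_le : ((latticeNet ι).card : ℝ) ≤ Real.exp (3.1 * Fintype.card ι) := by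
  classical
  have hl1 : ∀ k ∈ latticeNet ι, ∑ i, |(k i : ℝ)| ≤ 4 * Fintype.card ι := by
    intro k hk
    have h1 := sum_sq_le_of_mem_latticeNet hk
    -- the arithmetic-geometric mean inequality `|k i| ≤ (k i ^ 2 + 16) / 8`
    have h2 : ∀ i, |(k i : ℝ)| ≤ (k i : ℝ) ^ 2 / 8 + 2 := fun i => by
      nlinarith [sq_nonneg (|(k i : ℝ)| - 4), sq_abs (k i : ℝ)]
    refine (Finset.sum_le_sum fun i _ => h2 i).trans ?_
    rw [Finset.sum_add_distrib, ← Finset.sum_div, Finset.sum_const, Finset.card_univ,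
      nsmul_eq_mul]
    linarith
  have h := card_le_exp_mul_pow (latticeNet ι) ((latticeNet ι).biUnion fun k =>
    Finset.univ.image k) (s := 1 / 4) (by norm_num)
    (fun k hk i => Finset.mem_biUnion.2 ⟨k, hk, Finset.mem_image_of_mem _ (Finset.mem_univ i)⟩) hl1
  have hsum := sum_exp_neg_mul_abs_le ((latticeNet ι).biUnion fun k => Finset.univ.image k)
    (s := 1 / 4) (by norm_num) (m := 1) fun v _ hv => by simpa using Int.one_le_abs hv
  have hnum : 1 + 2 * (Real.exp (-(1 / 4) * (1 : ℕ)) / (1 - Real.exp (-(1 / 4))))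
      ≤ Real.exp 2.1 := by
    have h1 : (1.283 : ℝ) ≤ Real.exp (1 / 4) := by
      have h8 := Real.sum_le_exp_of_nonneg (x := 1 / 4) (by norm_num) 4
      norm_num [Finset.sum_range_succ, Nat.factorial] at h8
      linarith
    have h2 : Real.exp (-(1 / 4)) ≤ 0.7795 := by
      rw [Real.exp_neg, inv_le_comm₀ (Real.exp_pos _) (by norm_num)]
      exact le_trans (by norm_num) h1
    have h3 : (8.1 : ℝ) ≤ Real.exp 2.1 := by
      have h8 := Real.sum_le_exp_of_nonneg (x := 2.1) (by norm_num) 8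
      norm_num [Finset.sum_range_succ, Nat.factorial] at h8
      linarith
    have h4 : Real.exp (-(1 / 4)) / (1 - Real.exp (-(1 / 4))) ≤ 3.55 := by
      rw [div_le_iff₀ (by linarith)]; nlinarith
    simp only [Nat.cast_one, mul_one]
    linarith
  refine h.trans ?_
  have h5 := pow_le_pow_left₀ (Finset.sum_nonneg fun v _ => (Real.exp_pos _).le)
    (hsum.trans hnum) (Fintype.card ι)
  refine (mul_le_mul_of_nonneg_left h5 (Real.exp_pos _).le).trans_eq ?_
  rw [← Real.exp_nat_mul, ← Real.exp_add]
  congr 1; ring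

/-- Net points all of whose entries are small. -/
noncomputable def spreadNet (ι : Type*) [Fintype ι] (τ : ℝ) : Finset (ι → ℤ) :=
  open Classical in (latticeNet ι).filter fun k => ∀ i, (k i : ℝ) ^ 2 ≤ τ

/-- Net points all of whose nonzero entries are large. -/
noncomputable def sparseNet (ι : Type*) [Fintype ι] (τ : ℝ) : Finset (ι → ℤ) :=
  open Classical in (latticeNet ι).filter fun k => ∀ i, k i ≠ 0 → τ < (k i : ℝ) ^ 2

/-- The vectors of `sparseNet` are sparse, hence few. -/
lemma card_sparseNet_le {τ : ℝ} (hτ : 100 ≤ τ) :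
    ((sparseNet ι τ).card : ℝ)
      ≤ Real.exp ((32 * Real.log τ + 2) / τ * Fintype.card ι) := by
  classical
  set F := sparseNet ι τ
  have hτ0 : 0 < τ := by linarith
  have hq0 : 0 < √τ := Real.sqrt_pos.2 hτ0
  have hqq : √τ * √τ = τ := Real.mul_self_sqrt hτ0.le
  have habs : ∀ k ∈ F, ∀ i, k i ≠ 0 → √τ < |(k i : ℝ)| := by
    intro k hk i hi
    rw [← Real.sqrt_sq_eq_abs]
    exact Real.sqrt_lt_sqrt hτ0.le ((Finset.mem_filter.1 hk).2 i hi)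
  have hlog : 1 ≤ Real.log τ := by
    rw [Real.le_log_iff_exp_le hτ0]; linarith [Real.exp_one_lt_d9]
  have hl1 : ∀ k ∈ F, ∑ i, |(k i : ℝ)| ≤ 16 * Fintype.card ι / √τ := by
    intro k hk
    rw [le_div_iff₀ hq0, Finset.sum_mul]
    refine le_trans (Finset.sum_le_sum fun i _ => ?_)
      (sum_sq_le_of_mem_latticeNet (Finset.mem_filter.1 hk).1)
    rcases eq_or_ne (k i) 0 with h | h
    · simp [h]
    · rw [← sq_abs, sq]
      exact mul_le_mul_of_nonneg_left (habs k hk i h).le (abs_nonneg _)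
  set s := 2 * Real.log τ / √τ with hs
  have hs0 : 0 < s := by positivity
  have h := card_le_exp_mul_pow F (F.biUnion fun k => Finset.univ.image k) hs0.le
    (fun k hk i => Finset.mem_biUnion.2 ⟨k, hk, Finset.mem_image_of_mem _ (Finset.mem_univ i)⟩) hl1
  have hsum := sum_exp_neg_mul_abs_le (F.biUnion fun k => Finset.univ.image k) hs0
    (m := ⌈√τ⌉₊) fun v hv hv0 => by
      obtain ⟨k, hk, hkv⟩ := Finset.mem_biUnion.1 hv
      obtain ⟨i, -, rfl⟩ := Finset.mem_image.1 hkv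
      have h1 : √τ ≤ ((k i).natAbs : ℝ) := by
        rw [Nat.cast_natAbs, Int.cast_abs]; exact (habs k hk i hv0).le
      have h2 := Nat.ceil_le.2 h1
      rw [Int.abs_eq_natAbs]
      exact_mod_cast h2
  have hnum : 1 + 2 * (Real.exp (-s * (⌈√τ⌉₊ : ℕ)) / (1 - Real.exp (-s)))
      ≤ Real.exp (2 / τ) := by
    have h1 : Real.exp (-s * (⌈√τ⌉₊ : ℕ)) ≤ (τ ^ 2)⁻¹ := by
      have h2 : s * √τ ≤ s * (⌈√τ⌉₊ : ℕ) := mul_le_mul_of_nonneg_left (Nat.le_ceil _) hs0.le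
      have h3 : s * √τ = 2 * Real.log τ := by rw [hs]; field_simp
      have h4 : (τ ^ 2)⁻¹ = Real.exp (-(2 * Real.log τ)) := by
        rw [Real.exp_neg, mul_comm, Real.exp_mul, Real.exp_log hτ0]; norm_cast
      rw [h4]
      exact Real.exp_le_exp.2 (by linarith)
    have h2 : 1 / τ ≤ 1 - Real.exp (-s) := by
      have h3 : 1 + s ≤ Real.exp s := by linarith [Real.add_one_le_exp s]
      have h4 : Real.exp (-s) ≤ (1 + s)⁻¹ := by
        rw [Real.exp_neg]; exact inv_anti₀ (by linarith) h3
      have h5 : 1 ≤ s * (τ - 1) := by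
        have h6 : s = 2 * Real.log τ * √τ / τ := by
          rw [hs, div_eq_div_iff hq0.ne' hτ0.ne', mul_assoc _ √τ, hqq]
        have h7 : (10 : ℝ) ≤ √τ := Real.le_sqrt_of_sq_le (by linarith)
        rw [h6, div_mul_eq_mul_div, le_div_iff₀ hτ0]
        have h8 : 10 ≤ Real.log τ * √τ := by nlinarith
        nlinarith
      have h6 : 1 / τ ≤ 1 - (1 + s)⁻¹ := by
        have : 1 - (1 + s)⁻¹ = s / (1 + s) := by field_simp; ring
        rw [this, div_le_div_iff₀ hτ0 (by linarith)]; linarith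
      linarith
    have h3 : Real.exp (-s * (⌈√τ⌉₊ : ℕ)) / (1 - Real.exp (-s)) ≤ 1 / τ := by
      have h4 : 0 < 1 / τ := by positivity
      rw [div_le_iff₀ (by linarith)]
      calc Real.exp (-s * (⌈√τ⌉₊ : ℕ)) ≤ (τ ^ 2)⁻¹ := h1
        _ = 1 / τ * (1 / τ) := by field_simp
        _ ≤ _ := mul_le_mul_of_nonneg_left h2 h4.le
    have h4 := Real.add_one_le_exp (2 / τ)
    have h5 : 2 / τ = 2 * (1 / τ) := by ring
    linarith
  refine h.trans ?_
  have h5 := pow_le_pow_left₀ (Finset.sum_nonneg fun v _ => (Real.exp_pos _).le)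
    (hsum.trans hnum) (Fintype.card ι)
  refine (mul_le_mul_of_nonneg_left h5 (Real.exp_pos _).le).trans_eq ?_
  rw [← Real.exp_nat_mul, ← Real.exp_add]
  congr 1
  rw [hs, div_mul_div_comm, hqq]
  field_simp
  ring

end LatticeNet

/-! ### The operator norm of a Gaussian family of columns -/

section OperatorNorm

open scoped InnerProductSpace ENNReal

lemma integral_exp_sq_div_four_gaussianReal :
    ∫ x, Real.exp (x ^ 2 / 4) ∂(gaussianReal 0 1) = √2 := by
  have h : ∀ x : ℝ, gaussianPDFReal 0 1 x • Real.exp (x ^ 2 / 4)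
      = (√(2 * Real.pi))⁻¹ * Real.exp (-(1 / 4) * x ^ 2) := by
    intro x
    simp only [gaussianPDFReal, smul_eq_mul, NNReal.coe_one, mul_one, sub_zero]
    rw [mul_assoc, ← Real.exp_add]
    congr 2; ring
  rw [integral_gaussianReal_eq_integral_smul one_ne_zero]
  simp only [h]
  rw [integral_const_mul, integral_gaussian, ← Real.sqrt_inv, ← Real.sqrt_mul (by positivity)]
  congr 1
  have := Real.pi_pos
  field_simp
  norm_num

variable {ι κ : Type*} [Fintype ι] [Fintype κ]

lemma lintegral_exp_norm_sq_div_four :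
    ∫⁻ w, ENNReal.ofReal (Real.exp (‖w‖ ^ 2 / 4)) ∂(stdGaussian (EuclideanSpace ℝ κ))
      = ENNReal.ofReal (√2 ^ Fintype.card κ) := by
  have hint : Integrable (fun x : ℝ => Real.exp (x ^ 2 / 4)) (gaussianReal 0 1) := by
    refine Integrable.of_integral_ne_zero ?_
    rw [integral_exp_sq_div_four_gaussianReal]; positivity
  have hprod : ∀ x : κ → ℝ, Real.exp (‖WithLp.toLp 2 x‖ ^ 2 / 4)
      = ∏ i, Real.exp (x i ^ 2 / 4) := by
    intro x
    rw [EuclideanSpace.real_norm_sq_eq, Finset.sum_div, Real.exp_sum]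
  rw [← map_pi_eq_stdGaussian, lintegral_map (by fun_prop) (by fun_prop)]
  simp only [hprod]
  rw [← ofReal_integral_eq_lintegral_ofReal (Integrable.fintype_prod fun _ => hint)
    (ae_of_all _ fun x => by positivity),
    integral_fintype_prod_eq_prod (fun (_ : κ) (x : ℝ) => Real.exp (x ^ 2 / 4))]
  simp [integral_exp_sq_div_four_gaussianReal]

/-- The squared norm is linearised by an independent Gaussian vector `w`, using
`exp (‖v‖ ^ 2 / 4) = E exp ⟪v / √2, w⟫`. -/
lemma lintegral_exp_norm_sum_smul_sq_le {x : ι → ℝ} (hx : ∑ j, x j ^ 2 ≤ 1) :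
    ∫⁻ z, ENNReal.ofReal (Real.exp (‖∑ j, x j • z j‖ ^ 2 / 4)) ∂(stdGaussian (Columns ι κ))
      ≤ ENNReal.ofReal (√2 ^ Fintype.card κ) := by
  have hs : (√2)⁻¹ ^ 2 = (1 / 2 : ℝ) := by rw [inv_pow, Real.sq_sqrt (by norm_num)]; norm_num
  have h1 : ∀ z : Columns ι κ, ENNReal.ofReal (Real.exp (‖∑ j, x j • z j‖ ^ 2 / 4))
      = ∫⁻ w, ENNReal.ofReal (Real.exp ⟪(√2)⁻¹ • ∑ j, x j • z j, w⟫_ℝ)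
        ∂(stdGaussian (EuclideanSpace ℝ κ)) := by
    intro z
    rw [lintegral_exp_inner_stdGaussian, norm_smul, mul_pow, Real.norm_eq_abs, sq_abs, hs]
    congr 2; ring
  have h2 : ∀ w : EuclideanSpace ℝ κ,
      ∫⁻ z, ENNReal.ofReal (Real.exp ⟪(√2)⁻¹ • ∑ j, x j • z j, w⟫_ℝ)
        ∂(stdGaussian (Columns ι κ)) ≤ ENNReal.ofReal (Real.exp (‖w‖ ^ 2 / 4)) := by
    intro w
    set v : Columns ι κ := WithLp.toLp 2 fun j => ((√2)⁻¹ * x j) • w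
    have h3 : ∀ z : Columns ι κ, ⟪(√2)⁻¹ • ∑ j, x j • z j, w⟫_ℝ = ⟪v, z⟫_ℝ := by
      intro z
      rw [PiLp.inner_apply v z, real_inner_smul_left, sum_inner, Finset.mul_sum]
      refine Finset.sum_congr rfl fun j _ => ?_
      change _ = ⟪((√2)⁻¹ * x j) • w, z j⟫_ℝ
      rw [real_inner_smul_left, real_inner_smul_left, real_inner_comm]; ring
    have h4 : ‖v‖ ^ 2 = (∑ j, x j ^ 2) * (‖w‖ ^ 2 / 2) := by
      rw [PiLp.norm_sq_eq_of_L2, Finset.sum_mul]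
      refine Finset.sum_congr rfl fun j _ => ?_
      change ‖((√2)⁻¹ * x j) • w‖ ^ 2 = _
      rw [norm_smul, mul_pow, Real.norm_eq_abs, sq_abs, mul_pow, hs]; ring
    simp only [h3]
    rw [lintegral_exp_inner_stdGaussian, h4]
    refine ENNReal.ofReal_le_ofReal (Real.exp_le_exp.2 ?_)
    have := mul_le_mul_of_nonneg_right hx (by positivity : 0 ≤ ‖w‖ ^ 2 / 2)
    linarith
  simp only [h1]
  rw [lintegral_lintegral_swap
    (f := fun (z : Columns ι κ) w => ENNReal.ofReal (Real.exp ⟪(√2)⁻¹ • ∑ j, x j • z j, w⟫_ℝ))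
    (Measurable.aemeasurable ?_)]
  · exact (lintegral_mono h2).trans_eq lintegral_exp_norm_sq_div_four
  · refine Measurable.ennreal_ofReal (Continuous.measurable ?_)
    dsimp only [Function.uncurry_def]
    fun_prop

lemma stdGaussian_real_norm_sum_smul_sq_le {x : ι → ℝ} (hx : ∑ j, x j ^ 2 ≤ 1) (u : ℝ) :
    (stdGaussian (Columns ι κ)).real {z | u < ‖∑ j, x j • z j‖ ^ 2}
      ≤ Real.exp (-(u / 4)) * √2 ^ Fintype.card κ := by
  set T := {z : Columns ι κ | u < ‖∑ j, x j • z j‖ ^ 2}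
  have hTm : MeasurableSet T := measurableSet_lt measurable_const (by fun_prop)
  have h1 : ENNReal.ofReal (Real.exp (u / 4)) *
      ENNReal.ofReal ((stdGaussian (Columns ι κ)).real T)
      ≤ ENNReal.ofReal (√2 ^ Fintype.card κ) := by
    refine le_trans ?_ (lintegral_exp_norm_sum_smul_sq_le hx)
    rw [Measure.real, ENNReal.ofReal_toReal (measure_ne_top _ _), ← setLIntegral_const]
    refine (setLIntegral_mono' hTm fun z hz => ?_).trans (setLIntegral_le_lintegral _ _)
    exact ENNReal.ofReal_le_ofReal (Real.exp_le_exp.2 (by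
      have : u < ‖∑ j, x j • z j‖ ^ 2 := hz
      linarith))
  rw [← ENNReal.ofReal_mul (Real.exp_pos _).le, ENNReal.ofReal_le_ofReal_iff (by positivity)] at h1
  rw [Real.exp_neg, inv_mul_eq_div, le_div_iff₀ (Real.exp_pos _)]
  linarith

/-- It suffices to test the operator norm on the net. -/
lemma mem_boundedColumns_of_forall_netPoint [Nonempty ι] {z : Columns ι κ} {R : ℝ} (hR : 0 ≤ R)
    (h : ∀ k ∈ latticeNet ι, ‖∑ j, netPoint k j • z j‖ ^ 2 ≤ 9 / 16 * R) :
    z ∈ boundedColumns ι κ R := by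
  let L : EuclideanSpace ℝ ι →L[ℝ] EuclideanSpace ℝ κ :=
    ∑ j, (EuclideanSpace.proj j : EuclideanSpace ℝ ι →L[ℝ] ℝ).smulRight (z j)
  have hL : ∀ x, L x = ∑ j, x j • z j := fun x => by simp [L]
  have hsq : √(9 / 16 * R) = 3 / 4 * √R := by
    rw [Real.sqrt_mul (by norm_num), show (9 / 16 : ℝ) = (3 / 4) ^ 2 by norm_num,
      Real.sqrt_sq (by norm_num)]
  have hnorm : ‖L‖ ≤ √R := by
    have h1 := opNorm_le_of_forall_netPoint L (C := 3 / 4 * √R) (by positivity) fun k hk => by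
      rw [hL, ← hsq]
      exact Real.le_sqrt_of_sq_le (h k hk)
    linarith
  intro x
  have h1 := L.le_opNorm (WithLp.toLp 2 x)
  rw [hL] at h1
  calc ‖∑ j, x j • z j‖ ^ 2 ≤ (‖L‖ * ‖WithLp.toLp 2 x‖) ^ 2 :=
        pow_le_pow_left₀ (norm_nonneg _) h1 2
    _ ≤ R * ∑ j, x j ^ 2 := by
        rw [mul_pow, EuclideanSpace.real_norm_sq_eq]
        refine mul_le_mul_of_nonneg_right ?_ (Finset.sum_nonneg fun j _ => sq_nonneg _)
        rw [← Real.sq_sqrt hR]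
        exact pow_le_pow_left₀ (norm_nonneg _) hnorm 2

lemma stdGaussian_real_compl_boundedColumns_le [Nonempty ι] {R : ℝ} (hR : 0 ≤ R) :
    (stdGaussian (Columns ι κ)).real (boundedColumns ι κ R)ᶜ
      ≤ Real.exp (3.1 * Fintype.card ι) *
        (Real.exp (-(9 / 64 * R)) * √2 ^ Fintype.card κ) := by
  have hsub : (boundedColumns ι κ R)ᶜ ⊆
      ⋃ k ∈ latticeNet ι, {z | 9 / 16 * R < ‖∑ j, netPoint k j • z j‖ ^ 2} := by
    intro z hz
    by_contra hcon
    simp only [Set.mem_iUnion, not_exists, Set.mem_ofPred_eq, not_lt] at hcon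
    exact hz (mem_boundedColumns_of_forall_netPoint hR hcon)
  calc (stdGaussian (Columns ι κ)).real (boundedColumns ι κ R)ᶜ
      ≤ (stdGaussian (Columns ι κ)).real
          (⋃ k ∈ latticeNet ι, {z | 9 / 16 * R < ‖∑ j, netPoint k j • z j‖ ^ 2}) :=
        measureReal_mono hsub (measure_ne_top _ _)
    _ ≤ ∑ k ∈ latticeNet ι, (stdGaussian (Columns ι κ)).real
          {z | 9 / 16 * R < ‖∑ j, netPoint k j • z j‖ ^ 2} :=
        measureReal_biUnion_finset_le _ _
    _ ≤ ∑ _k ∈ latticeNet ι, Real.exp (-(9 / 64 * R)) * √2 ^ Fintype.card κ := by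
        refine Finset.sum_le_sum fun k hk => ?_
        have h1 := stdGaussian_real_norm_sum_smul_sq_le (κ := κ) (sum_sq_netPoint_le_one hk)
          (9 / 16 * R)
        rwa [show 9 / 16 * R / 4 = 9 / 64 * R by ring] at h1
    _ ≤ _ := by
        rw [Finset.sum_const, nsmul_eq_mul]
        exact mul_le_mul_of_nonneg_right card_latticeNet_le (by positivity)

end OperatorNorm

/-! ### Uniform control over the net -/

section UniformBound

open scoped InnerProductSpace

variable {ι κ : Type*}

/-- The coefficients of the bilinear form at `(a, b)`, with the diagonal removed. -/
noncomputable def offDiagCoeff (a b : ι → ℝ) (i j : ι) : ℝ :=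
  open Classical in if i = j then 0 else a i * b j

lemma offDiagCoeff_self (a b : ι → ℝ) (i : ι) : offDiagCoeff a b i i = 0 := by
  simp [offDiagCoeff]

lemma offDiagCoeff_sq_le (a b : ι → ℝ) (i j : ι) :
    offDiagCoeff a b i j ^ 2 ≤ a i ^ 2 * b j ^ 2 := by
  unfold offDiagCoeff
  split_ifs
  · simpa using by positivity
  · rw [mul_pow]

variable [Fintype ι] [Fintype κ]

lemma sum_offDiagCoeff_sq_le {a b : ι → ℝ} (ha : ∑ i, a i ^ 2 ≤ 1) (hb : ∑ i, b i ^ 2 ≤ 1) :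
    ∑ i, ∑ j, offDiagCoeff a b i j ^ 2 ≤ 1 := by
  calc ∑ i, ∑ j, offDiagCoeff a b i j ^ 2 ≤ ∑ i, ∑ j, a i ^ 2 * b j ^ 2 :=
        Finset.sum_le_sum fun i _ => Finset.sum_le_sum fun j _ => offDiagCoeff_sq_le a b i j
    _ = (∑ i, a i ^ 2) * ∑ j, b j ^ 2 := by rw [Finset.sum_mul_sum]
    _ ≤ 1 := mul_le_one₀ ha (Finset.sum_nonneg fun j _ => sq_nonneg _) hb

variable {T ε : ℝ}

lemma gramForm_offDiagCoeff_comm (a b : ι → ℝ) (z : Columns ι κ) :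
    gramForm (offDiagCoeff a b) T ε z = gramForm (offDiagCoeff b a) T ε z := by
  unfold gramForm
  rw [Finset.sum_comm]
  refine Finset.sum_congr rfl fun i _ => Finset.sum_congr rfl fun j _ => ?_
  rw [real_inner_comm]
  congr 1
  unfold offDiagCoeff
  rcases eq_or_ne i j with rfl | h
  · simp
  · simp [h, h.symm, mul_comm]

lemma gramForm_offDiagCoeff_add (a b b' : ι → ℝ) (z : Columns ι κ) :
    gramForm (offDiagCoeff a fun i => b i + b' i) T ε z
      = gramForm (offDiagCoeff a b) T ε z + gramForm (offDiagCoeff a b') T ε z := by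
  simp only [gramForm, ← Finset.sum_add_distrib]
  refine Finset.sum_congr rfl fun i _ => Finset.sum_congr rfl fun j _ => ?_
  unfold offDiagCoeff
  split_ifs <;> ring

lemma exists_spread_add_sparse {k : ι → ℤ} (hk : k ∈ latticeNet ι) {τ : ℝ} (hτ : 0 ≤ τ) :
    ∃ l ∈ spreadNet ι τ, ∃ l' ∈ sparseNet ι τ,
      ∀ i, netPoint k i = netPoint l i + netPoint l' i := by
  classical
  have hmem : ∀ l : ι → ℤ, (∀ i, l i = 0 ∨ l i = k i) → l ∈ latticeNet ι := by
    intro l hl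
    refine mem_latticeNet.2 (le_trans (Finset.sum_le_sum fun i _ => ?_) (mem_latticeNet.1 hk))
    rcases hl i with h | h <;> rw [h]
    simpa using sq_nonneg (k i)
  refine ⟨fun i => if (k i : ℝ) ^ 2 ≤ τ then k i else 0, ?_,
    fun i => if (k i : ℝ) ^ 2 ≤ τ then 0 else k i, ?_, fun i => ?_⟩
  · refine Finset.mem_filter.2 ⟨hmem _ fun i => ?_, fun i => ?_⟩
    · split_ifs <;> simp
    · beta_reduce; split_ifs with h
      · exact h
      · simpa using hτ
  · refine Finset.mem_filter.2 ⟨hmem _ fun i => ?_, fun i => ?_⟩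
    · split_ifs <;> simp
    · beta_reduce; split_ifs with h
      · simp
      · exact fun _ => not_le.1 h
  · simp only [netPoint]
    split_ifs <;> simp

/-- The families of columns with bounded matrix for which the thresholded Gram form is at
most `C` at all pairs of net points. -/
def controlledColumns (ι κ : Type*) [Fintype ι] [Fintype κ] (R T ε C : ℝ) :
    Set (Columns ι κ) :=
  boundedColumns ι κ R ∩ {z | ∀ k ∈ latticeNet ι, ∀ l ∈ latticeNet ι,
    gramForm (offDiagCoeff (netPoint k) (netPoint l)) T ε z ≤ C}

lemma measurableSet_controlledColumns (R T ε C : ℝ) :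
    MeasurableSet (controlledColumns ι κ R T ε C) := by
  refine (isClosed_boundedColumns R).measurableSet.inter (IsClosed.measurableSet ?_)
  simp only [Set.ofPred_forall]
  exact isClosed_iInter fun k => isClosed_iInter fun _ => isClosed_iInter fun l =>
    isClosed_iInter fun _ => isClosed_le continuous_gramForm continuous_const

/-- Outside the controlled set, the columns are unbounded, or the form is large at a pair with a
spread second vector, or it is large at a pair of sparse vectors. -/
lemma compl_controlledColumns_subset {τ : ℝ} (hτ : 0 ≤ τ) (R t₁ t₂ : ℝ) :
    (controlledColumns ι κ R T ε (2 * t₁ + t₂))ᶜ ⊆ (boundedColumns ι κ R)ᶜ ∪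
      ((⋃ q ∈ latticeNet ι ×ˢ spreadNet ι τ, boundedColumns ι κ R ∩
        {z | t₁ < gramForm (offDiagCoeff (netPoint q.1) (netPoint q.2)) T ε z}) ∪
      ⋃ q ∈ sparseNet ι τ ×ˢ sparseNet ι τ, boundedColumns ι κ R ∩
        {z | t₂ < gramForm (offDiagCoeff (netPoint q.1) (netPoint q.2)) T ε z}) := by
  intro z hz
  by_contra hcon
  simp only [Set.mem_union, not_or, Set.mem_compl_iff, not_not, Set.mem_iUnion, not_exists,
    Set.mem_inter_iff, not_and, Set.mem_ofPred_eq, not_lt, Finset.mem_product, and_imp,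
    Prod.forall] at hcon
  obtain ⟨hR, h1, h2⟩ := hcon
  refine hz ⟨hR, fun k hk l hl => ?_⟩
  obtain ⟨k₁, hk₁, k₂, hk₂, hk₁₂⟩ := exists_spread_add_sparse hk hτ
  obtain ⟨l₁, hl₁, l₂, hl₂, hl₁₂⟩ := exists_spread_add_sparse hl hτ
  have hl₂' : l₂ ∈ latticeNet ι := (Finset.mem_filter.1 hl₂).1
  have e1 : gramForm (offDiagCoeff (netPoint k) (netPoint l)) T ε z
      = gramForm (offDiagCoeff (netPoint k) (netPoint l₁)) T ε z
        + gramForm (offDiagCoeff (netPoint k) (netPoint l₂)) T ε z := by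
    rw [← gramForm_offDiagCoeff_add]
    congr 2; exact funext hl₁₂
  have e2 : gramForm (offDiagCoeff (netPoint k) (netPoint l₂)) T ε z
      = gramForm (offDiagCoeff (netPoint l₂) (netPoint k₁)) T ε z
        + gramForm (offDiagCoeff (netPoint k₂) (netPoint l₂)) T ε z := by
    rw [gramForm_offDiagCoeff_comm, gramForm_offDiagCoeff_comm (netPoint k₂),
      ← gramForm_offDiagCoeff_add]
    congr 2; exact funext hk₁₂
  have b1 := h1 k l₁ hk hl₁ hR
  have b2 := h1 l₂ k₁ hl₂' hk₁ hR
  have b3 := h2 k₂ l₂ hk₂ hl₂ hR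
  linarith

/-- Union bound over a set of pairs of net points. -/
lemma stdGaussian_real_biUnion_gramForm_le (A : Finset ((ι → ℤ) × (ι → ℤ))) {R B t : ℝ}
    (hhalf : 1 / 2 ≤ (stdGaussian (Columns ι κ)).real (boundedColumns ι κ R)) (hB0 : 0 < B)
    (hB : ∀ q ∈ A, ∀ z ∈ boundedColumns ι κ (2 * R),
      ‖gramGradient (offDiagCoeff (netPoint q.1) (netPoint q.2)) T ε z‖ ^ 2 ≤ B) (ht : 0 < t) :
    (stdGaussian (Columns ι κ)).real (⋃ q ∈ A, boundedColumns ι κ R ∩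
        {z | t < gramForm (offDiagCoeff (netPoint q.1) (netPoint q.2)) T ε z})
      ≤ A.card * (2 * Real.exp (-(2 * t ^ 2 / (Real.pi ^ 2 * B)))) := by
  refine (measureReal_biUnion_finset_le _ _).trans ?_
  rw [← nsmul_eq_mul, ← Finset.sum_const]
  exact Finset.sum_le_sum fun q hq =>
    stdGaussian_real_gramForm_le (offDiagCoeff_self _ _) hhalf hB0 (hB q hq) ht

theorem stdGaussian_real_compl_controlledColumns_le [Nonempty ι] {R τ t₁ t₂ : ℝ} (hR : 0 < R)
    (hT : 0 < T) (hε : 0 < ε) (hτ : 100 ≤ τ) (ht₁ : 0 < t₁) (ht₂ : 0 < t₂)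
    (hhalf : 1 / 2 ≤ (stdGaussian (Columns ι κ)).real (boundedColumns ι κ R)) :
    (stdGaussian (Columns ι κ)).real (controlledColumns ι κ R T ε (2 * t₁ + t₂))ᶜ ≤
      (stdGaussian (Columns ι κ)).real (boundedColumns ι κ R)ᶜ
      + Real.exp (6.2 * Fintype.card ι) * (2 * Real.exp (-(2 * t₁ ^ 2 / (Real.pi ^ 2 *
          (4 * (2 * R) * (τ / (16 * Fintype.card ι) * ((2 * R) ^ 2 / T ^ 2)))))))
      + Real.exp (2 * ((32 * Real.log τ + 2) / τ * Fintype.card ι)) *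
          (2 * Real.exp (-(2 * t₂ ^ 2 / (Real.pi ^ 2 * (4 * (2 * R)))))) := by
  classical
  have hp : (0 : ℝ) < Fintype.card ι := by exact_mod_cast Fintype.card_pos
  have hτ0 : 0 < τ := by linarith
  have hspread := stdGaussian_real_biUnion_gramForm_le (T := T) (ε := ε)
    (latticeNet ι ×ˢ spreadNet ι τ) hhalf
    (B := 4 * (2 * R) * (τ / (16 * Fintype.card ι) * ((2 * R) ^ 2 / T ^ 2))) (by positivity)
    (by
      rintro ⟨k, l⟩ hq z hz
      obtain ⟨hk, hl⟩ := Finset.mem_product.1 hq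
      refine norm_sq_gramGradient_le_of_spread hz (by positivity) hε hT
        (sum_sq_netPoint_le_one hk) (by positivity) fun i j =>
          (offDiagCoeff_sq_le _ _ i j).trans (mul_le_mul_of_nonneg_left ?_ (sq_nonneg _))
      rw [netPoint_sq]
      exact div_le_div_of_nonneg_right ((Finset.mem_filter.1 hl).2 j) (by positivity)) ht₁
  have hsparse := stdGaussian_real_biUnion_gramForm_le (T := T) (ε := ε)
    (sparseNet ι τ ×ˢ sparseNet ι τ) hhalf (B := 4 * (2 * R)) (by positivity)
    (by
      rintro ⟨k, l⟩ hq z hz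
      obtain ⟨hk, hl⟩ := Finset.mem_product.1 hq
      exact norm_sq_gramGradient_le_of_sum_sq_le hz (by positivity)
        (sum_offDiagCoeff_sq_le (sum_sq_netPoint_le_one (Finset.mem_filter.1 hk).1)
          (sum_sq_netPoint_le_one (Finset.mem_filter.1 hl).1))) ht₂
  have hcard₁ : ((latticeNet ι ×ˢ spreadNet ι τ).card : ℝ)
      ≤ Real.exp (6.2 * Fintype.card ι) := by
    have h1 := card_latticeNet_le (ι := ι)
    have h2 : ((spreadNet ι τ).card : ℝ) ≤ (latticeNet ι).card := by
      exact_mod_cast Finset.card_filter_le _ _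
    rw [Finset.card_product, Nat.cast_mul,
      show 6.2 * (Fintype.card ι : ℝ) = 3.1 * Fintype.card ι + 3.1 * Fintype.card ι by ring,
      Real.exp_add]
    exact mul_le_mul h1 (h2.trans h1) (by positivity) (Real.exp_pos _).le
  have hcard₂ : ((sparseNet ι τ ×ˢ sparseNet ι τ).card : ℝ)
      ≤ Real.exp (2 * ((32 * Real.log τ + 2) / τ * Fintype.card ι)) := by
    have h1 := card_sparseNet_le (ι := ι) hτ
    rw [Finset.card_product, Nat.cast_mul, two_mul, Real.exp_add]
    exact mul_le_mul h1 h1 (by positivity) (Real.exp_pos _).le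
  refine (measureReal_mono (compl_controlledColumns_subset hτ0.le R t₁ t₂)
    (measure_ne_top _ _)).trans ((measureReal_union_le _ _).trans ?_)
  rw [add_assoc]
  refine add_le_add_right ((measureReal_union_le _ _).trans (add_le_add ?_ ?_)) _
  · exact hspread.trans (mul_le_mul_of_nonneg_right hcard₁ (by positivity))
  · exact hsparse.trans (mul_le_mul_of_nonneg_right hcard₂ (by positivity))

end UniformBound

/-! ### The noise matrix and the thresholded Gram form -/

section NoiseMatrix

open scoped InnerProductSpace

variable {p : ℕ}

lemma inner_toEuclideanCLM_apply (A : Matrix (Fin p) (Fin p) ℝ) (x y : EuclideanSpace ℝ (Fin p)) :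
    ⟪x, Matrix.toEuclideanCLM (n := Fin p) (𝕜 := ℝ) A y⟫_ℝ = ∑ i, ∑ j, x i * A i j * y j := by
  rw [PiLp.inner_apply]
  refine Finset.sum_congr rfl fun i _ => ?_
  rw [Matrix.ofLp_toEuclideanCLM]
  simp only [Matrix.mulVec, dotProduct, RCLike.inner_apply, conj_trivial, Finset.sum_mul]
  exact Finset.sum_congr rfl fun j _ => by ring

lemma opNorm_le_of_forall_sum_le {A : Matrix (Fin p) (Fin p) ℝ} {C : ℝ} (hC : 0 ≤ C)
    (h : ∀ x y : EuclideanSpace ℝ (Fin p), ∑ i, ∑ j, x i * A i j * y j ≤ C * ‖x‖ * ‖y‖) :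
    opNorm A ≤ C := by
  refine ContinuousLinearMap.opNorm_le_bound _ hC fun y => ?_
  set w := Matrix.toEuclideanCLM (n := Fin p) (𝕜 := ℝ) A y with hw
  have h1 := h w y
  rw [← inner_toEuclideanCLM_apply, ← hw, real_inner_self_eq_norm_sq] at h1
  rcases (norm_nonneg w).eq_or_lt with h2 | h2
  · rw [← h2]; positivity
  · nlinarith

lemma sum_mul_mul_le_opNorm (A : Matrix (Fin p) (Fin p) ℝ) (x y : EuclideanSpace ℝ (Fin p)) :
    ∑ i, ∑ j, x i * A i j * y j ≤ opNorm A * ‖x‖ * ‖y‖ := by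
  rw [← inner_toEuclideanCLM_apply]
  refine (real_inner_le_norm _ _).trans ?_
  have := (Matrix.toEuclideanCLM (n := Fin p) (𝕜 := ℝ) A).le_opNorm y
  calc ‖x‖ * _ ≤ ‖x‖ * (opNorm A * ‖y‖) := mul_le_mul_of_nonneg_left this (norm_nonneg _)
    _ = _ := by ring

lemma opNorm_add_le (A B : Matrix (Fin p) (Fin p) ℝ) : opNorm (A + B) ≤ opNorm A + opNorm B := by
  unfold opNorm
  rw [map_add]
  exact norm_add_le _ _

/-- Setting the rows and columns with index in `Q` to zero does not increase the norm. -/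
lemma opNorm_compression_le (Q : Set (Fin p)) {A B : Matrix (Fin p) (Fin p) ℝ}
    (hin : ∀ i j, i ∉ Q → j ∉ Q → A i j = B i j)
    (hout : ∀ i j, i ∈ Q ∨ j ∈ Q → A i j = 0) : opNorm A ≤ opNorm B := by
  classical
  have hB0 : 0 ≤ opNorm B := norm_nonneg _
  refine opNorm_le_of_forall_sum_le hB0 fun x y => ?_
  let r : EuclideanSpace ℝ (Fin p) → EuclideanSpace ℝ (Fin p) :=
    fun x => WithLp.toLp 2 fun i => if i ∈ Q then 0 else x i
  have hr : ∀ x i, r x i = if i ∈ Q then 0 else x i := fun x i => rfl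
  have hrn : ∀ x, ‖r x‖ ≤ ‖x‖ := by
    intro x
    rw [EuclideanSpace.norm_eq, EuclideanSpace.norm_eq]
    refine Real.sqrt_le_sqrt (Finset.sum_le_sum fun i _ => ?_)
    rw [hr]
    split_ifs
    · simpa using sq_nonneg (x i)
    · rfl
  calc ∑ i, ∑ j, x i * A i j * y j = ∑ i, ∑ j, r x i * B i j * r y j := by
        refine Finset.sum_congr rfl fun i _ => Finset.sum_congr rfl fun j _ => ?_
        rw [hr, hr]
        by_cases hi : i ∈ Q
        · simp [hi, hout i j (Or.inl hi)]
        by_cases hj : j ∈ Q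
        · simp [hj, hout i j (Or.inr hj)]
        simp [hi, hj, hin i j hi hj]
    _ ≤ opNorm B * ‖r x‖ * ‖r y‖ := sum_mul_mul_le_opNorm B _ _
    _ ≤ opNorm B * ‖x‖ * ‖y‖ := by gcongr <;> exact hrn _

lemma opNorm_le_of_abs_le {A : Matrix (Fin p) (Fin p) ℝ} {δ : ℝ} (hδ : 0 ≤ δ)
    (h : ∀ i j, |A i j| ≤ δ) : opNorm A ≤ p * δ := by
  refine opNorm_le_of_forall_sum_le (by positivity) fun x y => ?_
  have hl1 : ∀ x : EuclideanSpace ℝ (Fin p), (∑ i, |x i|) ^ 2 ≤ p * ‖x‖ ^ 2 := by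
    intro x
    have h1 := sq_sum_le_card_mul_sum_sq (s := Finset.univ) (f := fun i => |x i|)
    simpa [EuclideanSpace.real_norm_sq_eq] using h1
  calc ∑ i, ∑ j, x i * A i j * y j ≤ ∑ i, ∑ j, |x i| * δ * |y j| := by
        refine Finset.sum_le_sum fun i _ => Finset.sum_le_sum fun j _ => ?_
        refine (le_abs_self _).trans ?_
        rw [abs_mul, abs_mul]
        gcongr; exact h i j
    _ = δ * ((∑ i, |x i|) * ∑ j, |y j|) := by
        rw [Finset.sum_mul_sum, Finset.mul_sum]
        refine Finset.sum_congr rfl fun i _ => ?_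
        rw [Finset.mul_sum]
        exact Finset.sum_congr rfl fun j _ => by ring
    _ ≤ δ * (p * ‖x‖ * ‖y‖) := by
        refine mul_le_mul_of_nonneg_left ?_ hδ
        refine abs_le_of_sq_le_sq' ?_ (by positivity) |>.2
        rw [mul_pow]
        calc (∑ i, |x i|) ^ 2 * (∑ j, |y j|) ^ 2 ≤ (p * ‖x‖ ^ 2) * (p * ‖y‖ ^ 2) :=
              mul_le_mul (hl1 x) (hl1 y) (sq_nonneg _) (by positivity)
          _ = _ := by ring
    _ = _ := by ring

/-- The columns of a matrix. -/
def matrixColumns {n : ℕ} (Z : Matrix (Fin n) (Fin p) ℝ) : Columns (Fin p) (Fin n) :=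
  WithLp.toLp 2 fun j => WithLp.toLp 2 fun i => Z i j

lemma inner_matrixColumns {n : ℕ} (Z : Matrix (Fin n) (Fin p) ℝ) (i j : Fin p) :
    ⟪matrixColumns Z i, matrixColumns Z j⟫_ℝ = (Z.transpose * Z) i j := by
  rw [PiLp.inner_apply, Matrix.mul_apply]
  refine Finset.sum_congr rfl fun k _ => ?_
  simp [matrixColumns, mul_comm]

lemma softThreshold_div {n : ℝ} (hn : 0 < n) (t x : ℝ) :
    softThreshold (t / n) (x / n) = softThreshold t x / n := by
  have h1 : Real.sign (x / n) = Real.sign x := by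
    rcases lt_trichotomy x 0 with h | rfl | h
    · rw [Real.sign_of_neg h, Real.sign_of_neg (div_neg_of_neg_of_pos h hn)]
    · simp
    · rw [Real.sign_of_pos h, Real.sign_of_pos (div_pos h hn)]
  have h2 : |x / n| - t / n = (|x| - t) / n := by rw [abs_div, abs_of_pos hn, sub_div]
  have h3 : max ((|x| - t) / n) 0 = max (|x| - t) 0 / n := by
    rw [← max_div_div_right hn.le, zero_div]
  rw [softThreshold, softThreshold, h1, h2, h3, mul_div_assoc]

/-- The Gram matrix of the columns `z`, with zero diagonal, thresholded by the smooth threshold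
and divided by `n`. -/
noncomputable def smoothNoise {n : ℕ} (T ε : ℝ) (z : Columns (Fin p) (Fin n)) :
    Matrix (Fin p) (Fin p) ℝ :=
  Matrix.of fun i j => if i = j then 0 else smoothThreshold T ε ⟪z i, z j⟫_ℝ / n

lemma sum_mul_smoothNoise_mul {n : ℕ} (T ε : ℝ) (z : Columns (Fin p) (Fin n))
    (x y : Fin p → ℝ) :
    ∑ i, ∑ j, x i * smoothNoise T ε z i j * y j = gramForm (offDiagCoeff x y) T ε z / n := by
  simp only [gramForm, Finset.sum_div]
  refine Finset.sum_congr rfl fun i _ => Finset.sum_congr rfl fun j _ => ?_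
  simp only [smoothNoise, offDiagCoeff, Matrix.of_apply]
  split_ifs <;> ring

/-- The noise matrix is a compression of the smooth one, up to an entrywise error `ε / n`. -/
lemma opNorm_noiseMatrix_le {n : ℕ} (hn : 0 < n) (Q : Set (Fin p)) {τ ε : ℝ} (hτ : 0 ≤ τ)
    (hε : 0 < ε) (Z : Matrix (Fin n) (Fin p) ℝ) :
    opNorm (noiseMatrix Q τ Z)
      ≤ opNorm (smoothNoise (τ * √n) ε (matrixColumns Z)) + p * (ε / n) := by
  have hn' : (0 : ℝ) < n := by exact_mod_cast hn
  set S := smoothNoise (τ * √n) ε (matrixColumns Z) with hS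
  set N : Matrix (Fin p) (Fin p) ℝ := Matrix.of fun i j =>
    if i = j then 0 else softThreshold (τ * √n) ⟪matrixColumns Z i, matrixColumns Z j⟫_ℝ / n
    with hN
  have h1 : opNorm (noiseMatrix Q τ Z) ≤ opNorm N := by
    have hentry : ∀ i j, ((1 / (n : ℝ)) • (Z.transpose * Z)).map
        (softThreshold (τ / √(n : ℝ))) i j
        = softThreshold (τ * √n) ⟪matrixColumns Z i, matrixColumns Z j⟫_ℝ / n := by
      intro i j
      have : τ / √(n : ℝ) = τ * √n / n := by
        rw [div_eq_div_iff (Real.sqrt_pos.2 hn').ne' hn'.ne', mul_assoc,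
          Real.mul_self_sqrt hn'.le]
      rw [inner_matrixColumns, ← softThreshold_div hn', Matrix.map_apply, Matrix.smul_apply,
        smul_eq_mul, one_div_mul_eq_div, this]
    refine opNorm_compression_le Q (fun i j hi hj => ?_) fun i j hij => ?_
    · simp only [noiseMatrix, entryProj, Matrix.of_apply, hentry, hN]
      by_cases h : i = j
      · simp [h, hj, noisePositions, diagPositions]
      · simp [h, hi, hj, noisePositions, diagPositions]
    · have : (i, j) ∉ noisePositions Q := by
        rcases hij with h | h <;> simp [noisePositions, h]
      simp [noiseMatrix, entryProj, this]
  have h2 : opNorm (N - S) ≤ p * (ε / n) := by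
    refine opNorm_le_of_abs_le (by positivity) fun i j => ?_
    simp only [hN, hS, smoothNoise, Matrix.sub_apply, Matrix.of_apply]
    split_ifs
    · simpa using by positivity
    · rw [← sub_div, abs_div, abs_of_pos hn', abs_sub_comm]
      exact div_le_div_of_nonneg_right (abs_smoothThreshold_sub_le hε (by positivity) _) hn'.le
  calc opNorm (noiseMatrix Q τ Z) ≤ opNorm (S + (N - S)) := by rwa [add_sub_cancel]
    _ ≤ opNorm S + p * (ε / n) := (opNorm_add_le _ _).trans (add_le_add_right h2 _)

lemma opNorm_smoothNoise_le [NeZero p] {n : ℕ} {R T ε C : ℝ} (hC : 0 ≤ C)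
    {z : Columns (Fin p) (Fin n)} (hz : z ∈ controlledColumns (Fin p) (Fin n) R T ε C) :
    opNorm (smoothNoise T ε z) ≤ 2 * (C / n) := by
  refine opNorm_le_of_forall_inner_netPoint _ (by positivity) fun k hk l hl => ?_
  rw [inner_toEuclideanCLM_apply, sum_mul_smoothNoise_mul]
  exact div_le_div_of_nonneg_right (hz.2 k hk l hl) (by positivity)

end NoiseMatrix

/-! ### The law of the columns -/

section Transfer

/-- Regrouping the entries of a matrix by columns. -/
noncomputable def columnsEquiv (n p : ℕ) :
    EuclideanSpace ℝ (Fin n × Fin p) ≃ₗᵢ[ℝ] Columns (Fin p) (Fin n) where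
  toFun x := WithLp.toLp 2 fun j => WithLp.toLp 2 fun i => x (i, j)
  invFun z := WithLp.toLp 2 fun ij => z ij.2 ij.1
  map_add' _ _ := rfl
  map_smul' _ _ := rfl
  left_inv _ := rfl
  right_inv _ := rfl
  norm_map' x := by
    rw [PiLp.norm_eq_of_L2, EuclideanSpace.norm_eq]
    congr 1
    rw [Fintype.sum_prod_type_right]
    refine Finset.sum_congr rfl fun j _ => ?_
    change ‖(WithLp.toLp 2 fun i => x (i, j) : EuclideanSpace ℝ (Fin n))‖ ^ 2 = _
    rw [EuclideanSpace.norm_sq_eq]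

lemma IsStdGaussianMatrix.hasLaw_matrixColumns {Ω : Type*} [MeasurableSpace Ω] {P : Measure Ω}
    {n p : ℕ} {Z : Ω → Matrix (Fin n) (Fin p) ℝ} (hZ : IsStdGaussianMatrix P Z) :
    HasLaw (fun ω => matrixColumns (Z ω)) (stdGaussian (Columns (Fin p) (Fin n))) P := by
  have hm : ∀ ij : Fin n × Fin p, AEMeasurable (fun ω => Z ω ij.1 ij.2) P :=
    fun ij => (hZ.hasLaw ij.1 ij.2).aemeasurable
  have hm' : AEMeasurable (fun ω (ij : Fin n × Fin p) => Z ω ij.1 ij.2) P :=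
    aemeasurable_pi_lambda _ hm
  have h1 : P.map (fun ω (ij : Fin n × Fin p) => Z ω ij.1 ij.2)
      = Measure.pi fun _ => gaussianReal 0 1 := by
    rw [hZ.indep.map_fun_eq_pi_map hm]
    congr 1
    ext1 ij
    exact (hZ.hasLaw ij.1 ij.2).map_eq
  have h2 : (fun ω => matrixColumns (Z ω)) = (columnsEquiv n p ∘ WithLp.toLp 2) ∘
      fun ω (ij : Fin n × Fin p) => Z ω ij.1 ij.2 := rfl
  have hm2 : Measurable (columnsEquiv n p ∘ WithLp.toLp 2) :=
    (columnsEquiv n p).continuous.measurable.comp (by fun_prop)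
  refine ⟨h2 ▸ hm2.comp_aemeasurable hm', ?_⟩
  rw [h2, ← AEMeasurable.map_map_of_aemeasurable hm2.aemeasurable hm', h1,
    ← Measure.map_map (columnsEquiv n p).continuous.measurable (by fun_prop),
    map_pi_eq_stdGaussian, stdGaussian_map]

end Transfer

/-! ### Choice of the parameters -/

section Parameters

/-- The Chernoff exponent for pairs with a spread vector. The numerical constant satisfies
`1150 ^ 2 ≥ 7 * π ^ 2 * (80 / 3) ^ 3`. -/
lemma spread_exponent_ge {m m' n p τ : ℝ} (hn : 0 < n) (hp : 0 < p) (hτ : 0 < τ) (hm : 0 < m)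
    (hmm' : m ^ 3 ≤ m' ^ 2) :
    7 * p ≤ 2 * (1150 * m' * n / √τ) ^ 2 / (Real.pi ^ 2 *
      (4 * (2 * (80 / 3 * m * n)) * (τ / (16 * p) * ((2 * (80 / 3 * m * n)) ^ 2 /
        (τ * √n) ^ 2)))) := by
  have hpi := Real.pi_pos
  have hpi2 : Real.pi ^ 2 ≤ 9.87 := by nlinarith [Real.pi_lt_d4]
  have hden : Real.pi ^ 2 * (4 * (2 * (80 / 3 * m * n)) * (τ / (16 * p) *
      ((2 * (80 / 3 * m * n)) ^ 2 / (τ * √n) ^ 2)))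
      = Real.pi ^ 2 * (2 * (80 / 3) ^ 3 * m ^ 3 * n ^ 2 / (p * τ)) := by
    rw [mul_pow τ, Real.sq_sqrt hn.le]
    field_simp
    ring
  have hnum : 2 * (1150 * m' * n / √τ) ^ 2 = 2 * 1150 ^ 2 * m' ^ 2 * n ^ 2 / τ := by
    rw [div_pow, Real.sq_sqrt hτ.le]; ring
  rw [hden, hnum, le_div_iff₀ (by positivity)]
  have h1 : 7 * p * (Real.pi ^ 2 * (2 * (80 / 3) ^ 3 * m ^ 3 * n ^ 2 / (p * τ)))
      = 14 * (80 / 3) ^ 3 * (Real.pi ^ 2 * m ^ 3) * (n ^ 2 / τ) := by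
    field_simp
    norm_num
  have h2 : 2 * 1150 ^ 2 * m' ^ 2 * n ^ 2 / τ = 2 * 1150 ^ 2 * m' ^ 2 * (n ^ 2 / τ) := by ring
  rw [h1, h2]
  refine mul_le_mul_of_nonneg_right ?_ (by positivity)
  have h3 : Real.pi ^ 2 * m ^ 3 ≤ 9.87 * m' ^ 2 :=
    mul_le_mul hpi2 hmm' (by positivity) (by norm_num)
  nlinarith [sq_nonneg m']

/-- The Chernoff exponent for pairs of sparse vectors. -/
lemma sparse_exponent_ge {m n p τ : ℝ} (hn : 0 < n) (hp : 0 < p) (hτ : 0 < τ) (hm : 0 < m)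
    (hlog : 4 ≤ Real.log τ) (hpn : p ≤ 1.01 * m * n) :
    (64 * Real.log τ + 5) / τ * p ≤ 2 * (270 * m * n * √(Real.log τ / τ)) ^ 2 / (Real.pi ^ 2 *
      (4 * (2 * (80 / 3 * m * n)))) := by
  have hpi := Real.pi_pos
  have hpi2 : Real.pi ^ 2 ≤ 9.87 := by nlinarith [Real.pi_lt_d4]
  have hnum : 2 * (270 * m * n * √(Real.log τ / τ)) ^ 2
      = 2 * 270 ^ 2 * (m * n) ^ 2 * (Real.log τ / τ) := by
    rw [mul_pow, Real.sq_sqrt (by positivity)]; ring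
  rw [hnum, le_div_iff₀ (by positivity)]
  have hmn : 0 < m * n := by positivity
  calc (64 * Real.log τ + 5) / τ * p * (Real.pi ^ 2 * (4 * (2 * (80 / 3 * m * n))))
      ≤ (66 * Real.log τ) / τ * (1.01 * m * n) * (9.87 * (4 * (2 * (80 / 3 * m * n)))) := by
        gcongr
        linarith
    _ = (66 * 1.01 * 9.87 * 8 * (80 / 3)) * ((m * n) ^ 2 * (Real.log τ / τ)) := by ring
    _ ≤ (2 * 270 ^ 2) * ((m * n) ^ 2 * (Real.log τ / τ)) := by
        exact mul_le_mul_of_nonneg_right (by norm_num) (by positivity)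
    _ = _ := by ring

/-- The failure probabilities of the operator norm bound, of the spread pairs and of the sparse
pairs add up to the required one. -/
lemma exp_sum_le {p τ : ℝ} (hτ : 100 ≤ τ) (hp : 2 * τ ≤ p) :
    Real.exp (-(0.2 * p)) + 2 * Real.exp (-(0.8 * p)) + 2 * Real.exp (-(p / τ))
      ≤ 2 * Real.exp (-((1 / (4 * τ)) * p)) := by
  have hτ0 : 0 < τ := by linarith
  set y := p / τ with hy
  have hpy : p = τ * y := by rw [hy]; field_simp
  have hy2 : 2 ≤ y := by rw [hy, le_div_iff₀ hτ0]; exact hp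
  have h1 : Real.exp (-(0.2 * p)) ≤ Real.exp (-y) := Real.exp_le_exp.2 (by nlinarith)
  have h2 : Real.exp (-(0.8 * p)) ≤ Real.exp (-y) := Real.exp_le_exp.2 (by nlinarith)
  have h3 : (1 / (4 * τ)) * p = y / 4 := by rw [hpy]; field_simp
  have h4 : Real.exp (-(y / 4)) = Real.exp (-y) * Real.exp (3 / 4 * y) := by
    rw [← Real.exp_add]; congr 1; ring
  have h5 : (5 / 2 : ℝ) ≤ Real.exp (3 / 4 * y) := by
    have := Real.add_one_le_exp (3 / 4 * y)
    linarith
  rw [h3, h4]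
  nlinarith [Real.exp_pos (-y)]

lemma four_le_log {τ : ℝ} (hτ : 100 ≤ τ) : 4 ≤ Real.log τ := by
  rw [Real.le_log_iff_exp_le (by linarith)]
  have h1 : Real.exp 4 = Real.exp 1 ^ 4 := by rw [← Real.exp_nat_mul]; norm_num
  have h2 := pow_le_pow_left₀ (Real.exp_pos 1).le Real.exp_one_lt_d9.le 4
  rw [h1]
  exact h2.trans (le_trans (by norm_num) hτ)

/-- The operator norm of the columns exceeds `√(80 / 3 * m * n)` with exponentially small
probability: the exponent `9 / 64 * (80 / 3) * m * n = 3.75 * m * n` exceeds the entropy `3.1 * p` of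
the net together with the moment bound `0.35 * n`. -/
lemma stdGaussian_real_compl_boundedColumns_le_exp {n p : ℕ} [NeZero p] {m : ℝ} (hm : 0 < m)
    (hm1 : 1 ≤ m) (hpn : (p : ℝ) ≤ 1.01 * m * n) :
    (stdGaussian (Columns (Fin p) (Fin n))).real
      (boundedColumns (Fin p) (Fin n) (80 / 3 * m * n))ᶜ ≤ Real.exp (-(0.2 * p)) := by
  refine (stdGaussian_real_compl_boundedColumns_le (by positivity)).trans ?_
  have h1 : √2 ≤ Real.exp 0.35 := by
    refine Real.sqrt_le_iff.2 ⟨(Real.exp_pos _).le, ?_⟩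
    rw [← Real.exp_nat_mul, ← Real.log_le_iff_le_exp (by norm_num)]
    norm_num
    linarith [Real.log_two_lt_d9]
  have h2 : √2 ^ n ≤ Real.exp (n * 0.35) := by
    rw [Real.exp_nat_mul]
    exact pow_le_pow_left₀ (Real.sqrt_nonneg _) h1 n
  simp only [Fintype.card_fin]
  calc Real.exp (3.1 * p) * (Real.exp (-(9 / 64 * (80 / 3 * m * n))) * √2 ^ n)
      ≤ Real.exp (3.1 * p) * (Real.exp (-(9 / 64 * (80 / 3 * m * n))) * Real.exp (n * 0.35)) := by
        gcongr
    _ = Real.exp (3.1 * p + (-(9 / 64 * (80 / 3 * m * n)) + n * 0.35)) := by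
        rw [Real.exp_add, Real.exp_add]
    _ ≤ Real.exp (-(0.2 * p)) := by
        refine Real.exp_le_exp.2 ?_
        have h3 : (n : ℝ) ≤ m * n := le_mul_of_one_le_left (by positivity) hm1
        nlinarith

/-- Non-asymptotic bound. In the limit theorem `m` is `max 1 α` and `m'` is
`max 1 (α ^ (3 / 2))`. -/
theorem one_sub_le_real_opNorm_noiseMatrix_le {Ω : Type*} [MeasurableSpace Ω] {P : Measure Ω}
    [IsProbabilityMeasure P] {n p : ℕ} (hn : 0 < n) (hp : 0 < p)
    {Z : Ω → Matrix (Fin n) (Fin p) ℝ} (hZ : IsStdGaussianMatrix P Z) (Q : Set (Fin p))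
    {m m' τ : ℝ} (hm : 1 ≤ m) (hmm' : m ≤ m') (hmm3 : m ^ 3 ≤ m' ^ 2) (hτ : 100 ≤ τ)
    (hpn : (p : ℝ) ≤ 1.01 * m * n) (hpτ : 2 * τ ≤ p) :
    1 - 2 * Real.exp (-((1 / (4 * τ)) * (p : ℝ))) ≤
      P.real {ω | opNorm (noiseMatrix Q τ (Z ω)) ≤ 5000 * m' * √(Real.log τ / τ)} := by
  have : NeZero p := ⟨hp.ne'⟩
  have hn' : (0 : ℝ) < n := by exact_mod_cast hn
  have hp' : (0 : ℝ) < p := by exact_mod_cast hp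
  have hτ0 : 0 < τ := by linarith
  have hm0 : 0 < m := by linarith
  have hm'0 : 0 < m' := by linarith
  have hlog := four_le_log hτ
  set L := √(Real.log τ / τ) with hL
  have hL0 : 0 < L := Real.sqrt_pos.2 (by positivity)
  -- the spread scale `1 / √τ` is at most half of `L`, because `log τ ≥ 4`
  have hτL : 1 / √τ ≤ L / 2 := by
    rw [hL, Real.sqrt_div (by linarith)]
    have h2 : 2 ≤ √(Real.log τ) := Real.le_sqrt_of_sq_le (by linarith)
    have h3 := Real.sqrt_pos.2 hτ0
    rw [div_div, div_le_div_iff₀ h3 (by positivity)]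
    nlinarith
  set R := 80 / 3 * m * n
  set T := τ * √n
  -- the smoothing width is chosen so that the smoothing error of the norm is `L`
  set ε := n * L / p with hε
  set t₁ := 1150 * m' * n / √τ with ht₁
  set t₂ := 270 * m * n * L with ht₂
  have hR0 : 0 < R := by positivity
  have hT0 : 0 < T := by have := Real.sqrt_pos.2 hn'; positivity
  have hε0 : 0 < ε := by positivity
  have ht₁0 : 0 < t₁ := by have := Real.sqrt_pos.2 hτ0; positivity
  have ht₂0 : 0 < t₂ := by positivity
  set γ := stdGaussian (Columns (Fin p) (Fin n))
  set G := controlledColumns (Fin p) (Fin n) R T ε (2 * t₁ + t₂)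
  have hbound : γ.real (boundedColumns (Fin p) (Fin n) R)ᶜ ≤ Real.exp (-(0.2 * p)) :=
    stdGaussian_real_compl_boundedColumns_le_exp hm0 hm hpn
  have hhalf : 1 / 2 ≤ γ.real (boundedColumns (Fin p) (Fin n) R) := by
    have h1 := probReal_compl_eq_one_sub (μ := γ) (isClosed_boundedColumns
      (ι := Fin p) (κ := Fin n) R).measurableSet
    have h2 : Real.exp (-(0.2 * p)) ≤ 1 / 2 := by
      rw [Real.exp_neg, one_div]
      refine inv_anti₀ (by norm_num) ?_
      have := Real.add_one_le_exp (0.2 * (p : ℝ))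
      linarith
    linarith
  have hGc : γ.real Gᶜ ≤ 2 * Real.exp (-((1 / (4 * τ)) * (p : ℝ))) := by
    refine (stdGaussian_real_compl_controlledColumns_le hR0 hT0 hε0 hτ ht₁0 ht₂0 hhalf).trans
      (le_trans ?_ (exp_sum_le hτ hpτ))
    simp only [Fintype.card_fin]
    refine add_le_add (add_le_add hbound ?_) ?_
    · have h1 := spread_exponent_ge hn' hp' hτ0 hm0 hmm3
      rw [mul_left_comm, ← Real.exp_add]
      refine mul_le_mul_of_nonneg_left (Real.exp_le_exp.2 ?_) zero_le_two
      linarith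
    · have h1 := sparse_exponent_ge hn' hp' hτ0 hm0 hlog hpn
      rw [mul_left_comm, ← Real.exp_add]
      refine mul_le_mul_of_nonneg_left (Real.exp_le_exp.2 ?_) zero_le_two
      have h2 : (64 * Real.log τ + 5) / τ * (p : ℝ)
          = 2 * ((32 * Real.log τ + 2) / τ * p) + p / τ := by ring
      linarith
  have hGm : MeasurableSet G := measurableSet_controlledColumns _ _ _ _
  have hlaw := hZ.hasLaw_matrixColumns
  have hPG : P.real {ω | matrixColumns (Z ω) ∈ G} = γ.real G :=
    congrArg ENNReal.toReal (hlaw.measure_eq hGm)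
  have hsub : {ω | matrixColumns (Z ω) ∈ G} ⊆
      {ω | opNorm (noiseMatrix Q τ (Z ω)) ≤ 5000 * m' * L} := by
    intro ω hω
    have h1 := opNorm_noiseMatrix_le hn Q hτ0.le hε0 (Z ω)
    have h2 := opNorm_smoothNoise_le (by positivity : 0 ≤ 2 * t₁ + t₂) hω
    have h3 : (p : ℝ) * (ε / n) = L := by rw [hε]; field_simp
    have h4 : 2 * ((2 * t₁ + t₂) / n) = 4600 * m' * (1 / √τ) + 540 * m * L := by
      rw [ht₁, ht₂]; field_simp; ring
    have h5 : 4600 * m' * (1 / √τ) ≤ 4600 * m' * (L / 2) :=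
      mul_le_mul_of_nonneg_left hτL (by positivity)
    have h6 : m * L ≤ m' * L := mul_le_mul_of_nonneg_right hmm' hL0.le
    have h7 : L ≤ m * L := le_mul_of_one_le_left hL0.le hm
    rw [Set.mem_ofPred_eq]
    linarith
  have h1 := measureReal_mono hsub (measure_ne_top P _)
  have h2 := probReal_compl_eq_one_sub (μ := γ) hGm
  linarith

end Parameters

theorem mainTheorem4 (α : ℝ) (hα : 0 < α) (r : ℕ) (n p : ℕ → ℕ)
    (hn : Tendsto n atTop atTop) (hp : Tendsto p atTop atTop)
    (hnp : Tendsto (fun k => (p k : ℝ) / (n k : ℝ)) atTop (𝓝 α))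
    {Ω : ℕ → Type*} [∀ k, MeasurableSpace (Ω k)]
    (P : ∀ k, Measure (Ω k)) [∀ k, IsProbabilityMeasure (P k)]
    (Z : ∀ k, Ω k → Matrix (Fin (n k)) (Fin (p k)) ℝ)
    (hZ : ∀ k, IsStdGaussianMatrix (P k) (Z k))
    (τ : ℝ) (hτ : 100 * max 1 (α ^ 2 * Real.log α) ≤ τ) :
    ∀ᶠ k in atTop, ∀ v : Fin r → EuclideanSpace ℝ (Fin (p k)), Orthonormal ℝ v →
      1 - 2 * Real.exp (-((1 / (4 * τ)) * (p k : ℝ))) ≤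
        (P k).real {ω | opNorm (noiseMatrix (supportUnion v) τ (Z k ω)) ≤
          5000 * max 1 (α ^ (3 / 2 : ℝ)) * √(Real.log τ / τ)} := by
  have hτ100 : 100 ≤ τ := by
    have := le_max_left 1 (α ^ 2 * Real.log α)
    linarith
  have hpow : (α ^ (3 / 2 : ℝ)) ^ 2 = α ^ 3 := by
    rw [← Real.rpow_natCast, ← Real.rpow_mul hα.le]
    norm_num
  have hα' : (1 : ℝ) ≤ max 1 α := le_max_left _ _
  have hcmp : max 1 α ≤ max 1 (α ^ (3 / 2 : ℝ)) ∧
      max 1 α ^ 3 ≤ max 1 (α ^ (3 / 2 : ℝ)) ^ 2 := by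
    rcases le_total α 1 with h | h
    · rw [max_eq_left h, max_eq_left (Real.rpow_le_one hα.le h (by norm_num))]
      norm_num
    · rw [max_eq_right h, max_eq_right (Real.one_le_rpow h (by norm_num)), hpow]
      refine ⟨?_, le_rfl⟩
      calc α = α ^ (1 : ℝ) := (Real.rpow_one α).symm
        _ ≤ α ^ (3 / 2 : ℝ) := Real.rpow_le_rpow_of_exponent_le h (by norm_num)
  have hlt : α < 1.01 * max 1 α := by
    have := le_max_right 1 α
    linarith
  filter_upwards [hn.eventually_gt_atTop 0, hp.eventually_gt_atTop 0,
    hnp.eventually_lt_const hlt,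
    (tendsto_natCast_atTop_atTop.comp hp).eventually_ge_atTop (2 * τ)] with k h1 h2 h3 h4 v _
  have h1' : (0 : ℝ) < n k := by exact_mod_cast h1
  rw [div_lt_iff₀ h1'] at h3
  exact one_sub_le_real_opNorm_noiseMatrix_le h1 h2 (hZ k) _ hα' hcmp.1 hcmp.2 hτ100 h3.le h4
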